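/- Let $\{d_n\}_{n\ge 1}$ be a sequence of positive integers and $\{\mu_n\}_{n\ge 1}$ a non-increasing sequence of positive real numbers. The mixed $(2,2)$-ellipsoid with dimensions $\{d_n\}$ and semi-axes $\{\mu_n\}$ is $$\mathcal E_{2,2}=\Big\{x=(x_1,x_2,\dots),\ x_j\in\mathbb R^{d_j}\ :\ \Big(\sum_{j\ge 1}\frac{\|x_j\|_2^2}{\mu_j^2}\Big)^{1/2}\le 1\Big\},$$ a subset of the space $\ell^2$ of square-summable block sequences with norm $\|x\|_2=(\sum_j\|x_j\|_2^2)^{1/2}$. For $\rho>0$ let $N(\rho)$ be the smallest number of closed $\|\cdot\|_2$-balls of radius $\rho$, with centres in $\ell^2$, that cover $\mathcal E_{2,2}$. Write $\bar d_k=d_1+\dots+d_k$, and let $\log$ be the logarithm to base $2$. There are an absolute constant $C>0$ and numbers $\kappa_k=\kappa_k(\{d_n\},\gamma)$, depending only on $k$, the dimensions and $\gamma$, with $$\kappa_k = 1+O\Big(\frac{\gamma\,k\log(\bar d_k)}{\bar d_k}\Big),\qquad\text{precisely}\qquad |\kappa_k-1|\le C\,\frac{\gamma\,k\log(\bar d_k)}{\bar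 d_k}\quad\text{whenever } k\ge 1,\ \gamma\ge 1,\ d_1,\dots,d_k\ge 9,$$ such that the following holds. Let $\{d_n\}$, $\{\mu_n\}$ be as above, let $\varepsilon\in(0,\mu_1)$, let $\gamma\ge1$ (possibly depending on $\varepsilon$), let $k\ge1$ be such that $\mu_{k+1}\le\varepsilon<\mu_k$, and assume $d_1,\dots,d_k\ge 9$. Put $$\varepsilon_\gamma=\varepsilon\big(1+\bar d_k^{\,-\gamma}\sqrt{k+1}\big).$$ Then $N(\varepsilon_\gamma)$ is finite and $$\prod_{j=1}^k\mu_j^{d_j/\bar d_k}\ \le\ N(\varepsilon_\gamma)^{1/\bar d_k}\,\varepsilon_\gamma\ \le\ \kappa_k\prod_{j=1}^k\mu_j^{d_j/\bar d_k}.$$ -/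

import Mathlib

open scoped NNReal ENNReal

noncomputable section

/-- The space `ℓ²` of square-summable block sequences `(x₁, x₂, …) ∈ ℝ^{d₁} × ℝ^{d₂} × ⋯` with the
norm `‖·‖₂`. Blocks are numbered from `0` in the code: `d j` is the dimension of the
`(j+1)`-st block. -/
abbrev BlockSpace (d : ℕ → ℕ) : Type :=
  lp (fun j : ℕ => EuclideanSpace ℝ (Fin (d j))) 2

/-- The mixed ellipsoid norm `‖x‖_{2,2,μ} = (∑_j (‖x_j‖₂ / μ_j)²)^{1/2}`, with the value `∞` when
the series diverges. -/
def mixedEllipsoidNorm (d : ℕ → ℕ) (μ : ℕ → ℝ) (x : BlockSpace d) : ℝ≥0∞ :=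
  (∑' j : ℕ, ENNReal.ofReal ((‖x j‖ / μ j) ^ 2)) ^ (1 / 2 : ℝ)

/-- The mixed ellipsoid `E_{2,2}` with dimensions `d` and semi-axes `μ`. -/
def mixedEllipsoid (d : ℕ → ℕ) (μ : ℕ → ℝ) : Set (BlockSpace d) :=
  {x | mixedEllipsoidNorm d μ x ≤ 1}

/-- The covering number `N(ρ; E_{2,2}, ‖·‖₂)`: the smallest cardinality (in `ℕ∞`) of a set of
centres in `ℓ²` whose closed `ρ`-balls cover the mixed ellipsoid. -/
def mixedCoveringNumber (d : ℕ → ℕ) (μ : ℕ → ℝ) (ρ : ℝ) : ℕ∞ :=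
  Metric.externalCoveringNumber ρ.toNNReal (mixedEllipsoid d μ)

/-- The total dimension `d₁ + ⋯ + d_k` of the first `k` blocks. -/
def dimBar (d : ℕ → ℕ) (k : ℕ) : ℕ :=
  ∑ j ∈ Finset.range k, d j

/-- The radius `ε_γ = ε (1 + D^{-γ} √(k+1))`, where `D = d₁ + ⋯ + d_k`. -/
def epsGamma (d : ℕ → ℕ) (k : ℕ) (γ ε : ℝ) : ℝ :=
  ε * (1 + (dimBar d k : ℝ) ^ (-γ) * √((k : ℝ) + 1))

/-- The weighted geometric mean `∏_{j ≤ k} μ_j^{d_j / D}`, where `D = d₁ + ⋯ + d_k`. -/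
def semiAxisMean (d : ℕ → ℕ) (μ : ℕ → ℝ) (k : ℕ) : ℝ :=
  ∏ j ∈ Finset.range k, μ j ^ ((d j : ℝ) / (dimBar d k : ℝ))

end

/-!
Lower bound: the centres, projected to the first `k` blocks, cover the head ellipsoid in `ℝ^D` by
balls of radius `ε_γ`; compare volumes.

Upper bound: if `q` is the ellipsoid norm of the head of a point of the ellipsoid, then its tail has
squared norm at most `ε² (1 - q²)`. Hence it suffices to cover the head with squared error at most
`ε² (q² + σ)` where `σ = (k + 1) D^{-2γ}`, that is, with a precision that improves towards the
centre; rescaled copies of a single cover achieve this. Let `L = γ k log₂ D / D`.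

* If `L ≤ 1`, take products of covers of the blocks. A centre drawn uniformly from the ball of
  radius `√(1 - s²)`, slightly enlarged, is within about `s` of a given unit vector with probability
  of order `sⁿ / n`, since the two balls meet in a lens containing a slab of relative width `1 / n`
  of a ball of radius `s √(1 - s²)`. Random centres thus cover the unit ball of `ℝⁿ` by `O(n³ s⁻ⁿ)`
  balls of radius `s`, and the polynomial factors of the `k` blocks multiply to at most
  `D^{O(γ k)} = 2^{O(L D)}`.
* If `L ≥ 1`, a constant factor per dimension is affordable, so dyadic copies of a volumetric net
  of the whole head ellipsoid suffice.
-/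

section VolumeNets

open MeasureTheory Metric Module

theorem exists_finset_separated_net {X : Type*} [PseudoMetricSpace X] {K : Set X}
    (hK : TotallyBounded K) {r : ℝ} (hr : 0 < r) :
    ∃ S : Finset X, (S : Set X) ⊆ K ∧ (S : Set X).Pairwise (fun x y => r < dist x y) ∧
      ∀ x ∈ K, ∃ y ∈ S, dist x y ≤ r := by
  lift r to ℝ≥0 using hr.le
  have hpack : packingNumber r K ≠ ⊤ := by
    obtain ⟨N, -, hN, hcover⟩ :=
      exists_finite_isCover_of_totallyBounded (ε := r / 2) (by simpa using hr.ne') hK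
    have hle := packingNumber_two_mul_le_externalCoveringNumber (r / 2) K
    rw [mul_div_cancel₀ r two_ne_zero] at hle
    exact ((hle.trans hcover.externalCoveringNumber_le_encard).trans_lt hN.encard_lt_top).ne
  have hfinite : (maximalSeparatedSet r K).Finite := by
    rwa [← Set.encard_ne_top_iff, encard_maximalSeparatedSet hpack]
  refine ⟨hfinite.toFinset, by simpa using maximalSeparatedSet_subset, ?_, fun x hx => ?_⟩
  · intro x hx y hy hxy
    have hsep : (r : ℝ≥0∞) < edist x y :=
      isSeparated_maximalSeparatedSet (hfinite.mem_toFinset.1 hx) (hfinite.mem_toFinset.1 hy) hxy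
    rw [edist_nndist, ENNReal.coe_lt_coe] at hsep
    exact_mod_cast hsep
  · obtain ⟨y, hy, hxy⟩ := isCover_maximalSeparatedSet hpack hx
    change edist x y ≤ r at hxy
    rw [edist_nndist, ENNReal.coe_le_coe] at hxy
    exact ⟨y, hfinite.mem_toFinset.2 hy, mod_cast hxy⟩

variable {E : Type*} [NormedAddCommGroup E] [NormedSpace ℝ E] [FiniteDimensional ℝ E]

section Measure

variable [MeasurableSpace E] (ν : Measure E) [ν.IsAddHaarMeasure]

theorem measureReal_unitBall_pos : 0 < ν.real (ball 0 1) :=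
  ENNReal.toReal_pos (measure_ball_pos ν 0 one_pos).ne' measure_ball_lt_top.ne

variable [BorelSpace E]

theorem exists_finset_net_card_mul_le {K : Set E} (hK : Bornology.IsBounded K) {r : ℝ}
    (hr : 0 < r) :
    ∃ S : Finset E, (S : Set E) ⊆ K ∧ (∀ x ∈ K, ∃ y ∈ S, dist x y ≤ r) ∧
      (S.card : ℝ) * ((r / 2) ^ finrank ℝ E * ν.real (ball 0 1)) ≤
        ν.real (thickening (r / 2) K) := by
  obtain ⟨S, hSK, hsep, hnet⟩ := exists_finset_separated_net
      (hK.isCompact_closure.totallyBounded.subset subset_closure) hr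
  refine ⟨S, hSK, hnet, ?_⟩
  have hdisjoint : (S : Set E).PairwiseDisjoint fun x => ball x (r / 2) := fun x hx y hy hxy =>
    ball_disjoint_ball (by linarith [hsep hx hy hxy])
  calc (S.card : ℝ) * ((r / 2) ^ finrank ℝ E * ν.real (ball 0 1))
      = ∑ x ∈ S, ν.real (ball x (r / 2)) := by
        simp only [measureReal_def, Measure.addHaar_ball_of_pos ν _ (half_pos hr),
          ENNReal.toReal_mul, ENNReal.toReal_ofReal (pow_nonneg (half_pos hr).le _),
          Finset.sum_const, nsmul_eq_mul]
    _ = ν.real (⋃ x ∈ S, ball x (r / 2)) :=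
        (measureReal_biUnion_finset hdisjoint (fun _ _ => measurableSet_ball)
          fun _ _ => measure_ball_lt_top.ne).symm
    _ ≤ ν.real (thickening (r / 2) K) := by
        refine measureReal_mono (Set.iUnion₂_subset fun x hx => ?_)
          (Bornology.IsBounded.measure_lt_top (Bornology.IsBounded.thickening hK)).ne
        exact ball_subset_thickening (hSK hx) _

theorem measureReal_le_card_mul_of_cover {K : Set E} {S : Finset E} {ρ : ℝ} (hρ : 0 ≤ ρ)
    (hS : ∀ x ∈ K, ∃ c ∈ S, dist x c ≤ ρ) :
    ν.real K ≤ S.card * (ρ ^ finrank ℝ E * ν.real (ball 0 1)) := by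
  have hsub : K ⊆ ⋃ c ∈ S, closedBall c ρ := fun x hx => by
    obtain ⟨c, hc, hxc⟩ := hS x hx
    exact Set.mem_biUnion hc hxc
  have hfinite : ν (⋃ c ∈ S, closedBall c ρ) ≠ ∞ :=
    (measure_biUnion_lt_top S.finite_toSet fun _ _ => measure_closedBall_lt_top).ne
  calc ν.real K ≤ ν.real (⋃ c ∈ S, closedBall c ρ) := measureReal_mono hsub hfinite
    _ ≤ ∑ c ∈ S, ν.real (closedBall c ρ) := measureReal_biUnion_finset_le _ _
    _ = S.card * (ρ ^ finrank ℝ E * ν.real (ball 0 1)) := by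
        simp only [Measure.addHaar_real_closedBall ν _ hρ, Finset.sum_const, nsmul_eq_mul]

theorem measureReal_setOf_norm_map_le {A : E →ₗ[ℝ] E} (hA : LinearMap.det A ≠ 0) {t : ℝ}
    (ht : 0 ≤ t) :
    ν.real {x | ‖A x‖ ≤ t} = |LinearMap.det A|⁻¹ * (t ^ finrank ℝ E * ν.real (ball 0 1)) := by
  have hpreimage : {x | ‖A x‖ ≤ t} = A ⁻¹' closedBall 0 t := by ext x; simp
  rw [hpreimage, measureReal_def, Measure.addHaar_preimage_linearMap ν hA, ENNReal.toReal_mul,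
    ENNReal.toReal_ofReal (abs_nonneg _), abs_inv, ← measureReal_def,
    Measure.addHaar_real_closedBall ν _ ht]

end Measure

theorem isBounded_setOf_norm_map_le {A : E →ₗ[ℝ] E} (hA : LinearMap.det A ≠ 0) (t : ℝ) :
    Bornology.IsBounded {x | ‖A x‖ ≤ t} := by
  obtain ⟨K, -, hK⟩ := A.exists_antilipschitzWith
    (LinearMap.ker_eq_bot.2 (LinearMap.isUnit_iff_isUnit_det A |>.2 hA.isUnit |>
      (Module.End.isUnit_iff A).1).injective)
  refine (hK.isBounded_preimage isBounded_closedBall (s := closedBall 0 t)).subset fun x hx => ?_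
  simpa using hx

theorem inv_abs_det_le_card_mul_pow {A : E →ₗ[ℝ] E} (hA : LinearMap.det A ≠ 0) {S : Finset E}
    {ρ : ℝ} (hρ : 0 ≤ ρ) (hS : ∀ x, ‖A x‖ ≤ 1 → ∃ c ∈ S, ‖x - c‖ ≤ ρ) :
    |LinearMap.det A|⁻¹ ≤ S.card * ρ ^ finrank ℝ E := by
  borelize E
  let ν : Measure E := Measure.addHaar
  have hvol := measureReal_le_card_mul_of_cover ν hρ (K := {x | ‖A x‖ ≤ 1}) (S := S)
    (by simpa only [dist_eq_norm, Set.mem_ofPred_eq] using hS)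
  rw [measureReal_setOf_norm_map_le ν hA zero_le_one, one_pow, one_mul, ← mul_assoc] at hvol
  exact le_of_mul_le_mul_right hvol (measureReal_unitBall_pos ν)

theorem exists_finset_net_norm_map_le {A : E →ₗ[ℝ] E} (hA : LinearMap.det A ≠ 0) {ε r : ℝ}
    (hε : 0 < ε) (hr : 0 < r) (hAε : ∀ x, ε * ‖A x‖ ≤ ‖x‖) :
    ∃ S : Finset E, (∀ c ∈ S, ‖A c‖ ≤ 1) ∧ (∀ x, ‖A x‖ ≤ 1 → ∃ c ∈ S, ‖x - c‖ ≤ r) ∧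
      (S.card : ℝ) * (r / 2) ^ finrank ℝ E ≤
        |LinearMap.det A|⁻¹ * (1 + r / (2 * ε)) ^ finrank ℝ E := by
  borelize E
  let ν : Measure E := Measure.addHaar
  obtain ⟨S, hSK, hnet, hcard⟩ :=
    exists_finset_net_card_mul_le ν (isBounded_setOf_norm_map_le hA 1) hr
  refine ⟨S, fun c hc => hSK hc, by simpa only [dist_eq_norm, Set.mem_ofPred_eq] using hnet, ?_⟩
  have hthick : thickening (r / 2) {x | ‖A x‖ ≤ 1} ⊆ {x | ‖A x‖ ≤ 1 + r / (2 * ε)} := by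
    intro y hy
    obtain ⟨x, hx, hxy⟩ := mem_thickening_iff.1 hy
    have hdiff : ‖A (y - x)‖ ≤ r / (2 * ε) := by
      rw [le_div_iff₀ (by positivity)]
      linarith [hAε (y - x), dist_eq_norm y x]
    calc ‖A y‖ = ‖A x + A (y - x)‖ := by rw [← map_add, add_sub_cancel]
      _ ≤ 1 + r / (2 * ε) := (norm_add_le _ _).trans (add_le_add hx hdiff)
  have hvol := hcard.trans
    (measureReal_mono hthick (isBounded_setOf_norm_map_le hA _).measure_lt_top.ne)
  rw [measureReal_setOf_norm_map_le ν hA (by positivity), ← mul_assoc, ← mul_assoc] at hvol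
  exact le_of_mul_le_mul_right hvol (measureReal_unitBall_pos ν)

theorem exists_finset_net_unitBall {r : ℝ} (hr : 0 < r) :
    ∃ V : Finset E, (∀ v ∈ V, ‖v‖ ≤ 1) ∧ (∀ x : E, ‖x‖ ≤ 1 → ∃ v ∈ V, ‖x - v‖ ≤ r) ∧
      (V.card : ℝ) ≤ (1 + 2 / r) ^ finrank ℝ E := by
  obtain ⟨V, hV, hnet, hcard⟩ := exists_finset_net_norm_map_le (E := E) (A := LinearMap.id)
    (by simp) one_pos hr (by simp)
  refine ⟨V, hV, hnet, ?_⟩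
  rw [LinearMap.det_id, abs_one, inv_one, one_mul, ← le_div_iff₀ (by positivity),
    ← div_pow] at hcard
  refine hcard.trans_eq ?_
  congr 1
  field_simp
  ring

end VolumeNets

section Hitting

open MeasureTheory

variable {Ω ι : Type*} [MeasurableSpace Ω] {P : Measure Ω} [IsProbabilityMeasure P]
  {V : Finset ι} {G : ι → Set Ω} {p : ℝ}

open scoped Classical in
theorem exists_mul_card_le_card_filter_mem (hG : ∀ v ∈ V, MeasurableSet (G v))
    (hPG : ∀ v ∈ V, p ≤ P.real (G v)) :
    ∃ c, p * V.card ≤ ((V.filter fun v => c ∈ G v).card : ℝ) := by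
  have hintegrable : ∀ v ∈ V, Integrable ((G v).indicator fun _ => (1 : ℝ)) P := fun v hv =>
    (integrable_const 1).indicator (hG v hv)
  obtain ⟨c, hc⟩ := exists_integral_le (integrable_finsetSum V hintegrable)
  refine ⟨c, ?_⟩
  calc p * V.card = ∑ _v ∈ V, p := by rw [Finset.sum_const, nsmul_eq_mul, mul_comm]
    _ ≤ ∑ v ∈ V, ∫ c, (G v).indicator (fun _ => (1 : ℝ)) c ∂P := by
        refine Finset.sum_le_sum fun v hv => ?_
        rw [integral_indicator_const _ (hG v hv), smul_eq_mul, mul_one]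
        exact hPG v hv
    _ ≤ ∑ v ∈ V, (G v).indicator (fun _ => (1 : ℝ)) c := by
        rwa [integral_finsetSum V hintegrable] at hc
    _ = ((V.filter fun v => c ∈ G v).card : ℝ) := by simp [Set.indicator_apply, Finset.sum_boole]

open scoped Classical in
theorem exists_card_filter_forall_notMem_le (hG : ∀ v ∈ V, MeasurableSet (G v)) (hp1 : p ≤ 1)
    (hPG : ∀ v ∈ V, p ≤ P.real (G v)) (n : ℕ) :
    ∃ S : Finset Ω, S.card ≤ n ∧
      ((V.filter fun v => ∀ c ∈ S, c ∉ G v).card : ℝ) ≤ (1 - p) ^ n * V.card := by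
  induction n with
  | zero => exact ⟨∅, by simp⟩
  | succ n ih =>
    obtain ⟨S, hS, hmissed⟩ := ih
    set U := V.filter fun v => ∀ c ∈ S, c ∉ G v
    obtain ⟨c, hc⟩ := exists_mul_card_le_card_filter_mem (P := P) (V := U)
      (fun v hv => hG v (Finset.mem_filter.1 hv).1) fun v hv => hPG v (Finset.mem_filter.1 hv).1
    refine ⟨insert c S, (Finset.card_insert_le _ _).trans (by lia), ?_⟩
    have hinsert : (V.filter fun v => ∀ c' ∈ insert c S, c' ∉ G v) = U.filter fun v => c ∉ G v := by
      grind
    have hsplit : ((U.filter fun v => c ∈ G v).card : ℝ) + (U.filter fun v => c ∉ G v).card =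
        U.card := mod_cast U.card_filter_add_card_filter_not fun v => c ∈ G v
    calc ((V.filter fun v => ∀ c' ∈ insert c S, c' ∉ G v).card : ℝ)
        ≤ (1 - p) * U.card := by rw [hinsert]; linarith
      _ ≤ (1 - p) * ((1 - p) ^ n * V.card) := by gcongr
      _ = (1 - p) ^ (n + 1) * V.card := by ring

theorem exists_finset_hitting (hG : ∀ v ∈ V, MeasurableSet (G v)) (hp : 0 < p)
    (hPG : ∀ v ∈ V, p ≤ P.real (G v)) {L : ℝ} (hL : 0 ≤ L) :
    ∃ S : Finset Ω, (S.card : ℝ) ≤ L / p + 1 + Real.exp (-L) * V.card ∧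
      ∀ v ∈ V, ∃ c ∈ S, c ∈ G v := by
  classical
  rcases V.eq_empty_or_nonempty with rfl | ⟨v₀, hv₀⟩
  · exact ⟨∅, by simp only [Finset.card_empty, Nat.cast_zero, mul_zero, add_zero]; positivity,
      by simp⟩
  have hp1 : p ≤ 1 := (hPG v₀ hv₀).trans measureReal_le_one
  obtain ⟨S, hS, hmissed⟩ := exists_card_filter_forall_notMem_le hG hp1 hPG ⌈L / p⌉₊
  set U := V.filter fun v => ∀ c ∈ S, c ∉ G v
  have hdecay : (1 - p) ^ ⌈L / p⌉₊ ≤ Real.exp (-L) := by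
    calc (1 - p) ^ ⌈L / p⌉₊ ≤ Real.exp (-p) ^ ⌈L / p⌉₊ := by
          gcongr
          exact Real.one_sub_le_exp_neg p
      _ = Real.exp (-(⌈L / p⌉₊ * p)) := by rw [← Real.exp_nat_mul, mul_neg]
      _ ≤ Real.exp (-L) := by
          gcongr
          exact (div_le_iff₀ hp).1 (Nat.le_ceil _)
  have hnonempty : ∀ v ∈ V, (G v).Nonempty := fun v hv =>
    nonempty_of_measureReal_ne_zero (hp.trans_le (hPG v hv)).ne'
  have : Nonempty Ω := nonempty_of_isProbabilityMeasure P
  choose! f hf using hnonempty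
  refine ⟨S ∪ U.image f, ?_, fun v hv => ?_⟩
  · calc ((S ∪ U.image f).card : ℝ) ≤ S.card + U.card :=
        mod_cast (Finset.card_union_le _ _).trans (Nat.add_le_add_left Finset.card_image_le _)
      _ ≤ L / p + 1 + Real.exp (-L) * V.card := by
        gcongr
        · exact (Nat.cast_le.2 hS).trans (Nat.ceil_lt_add_one (by positivity)).le
        · exact hmissed.trans (by gcongr)
  · by_cases hhit : ∃ c ∈ S, c ∈ G v
    · exact hhit.imp fun c hc => ⟨Finset.mem_union_left _ hc.1, hc.2⟩
    · exact ⟨f v, Finset.mem_union_right _ (Finset.mem_image_of_mem f (by grind)), hf v hv⟩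

end Hitting

section Lens

open MeasureTheory Metric Module

variable {E : Type*} [NormedAddCommGroup E] [InnerProductSpace ℝ E]

theorem norm_sq_smul_add_le {a b δ t : ℝ} (ha : 0 ≤ a) (hab : a ^ 2 + b ^ 2 = 1)
    (hδ : 0 ≤ δ) (ht : 0 ≤ t) (hδt : 1 + δ ≤ t ^ 2) {v z : E} (hv : ‖v‖ ≤ 1)
    (hz : ‖z‖ ≤ a * b) (hvz : inner ℝ v z ≤ δ * (a * b)) : ‖a ^ 2 • v + z‖ ≤ a * t := by
  have hab_le : 2 * (a * b) ≤ 1 := by linarith [two_mul_le_add_sq a b]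
  have hv2 : ‖v‖ ^ 2 ≤ 1 := pow_le_one₀ (norm_nonneg v) hv
  have hz2 : ‖z‖ ^ 2 ≤ (a * b) ^ 2 := pow_le_pow_left₀ (norm_nonneg z) hz 2
  refine le_of_sq_le_sq ?_ (by positivity)
  calc ‖a ^ 2 • v + z‖ ^ 2 = (a ^ 2) ^ 2 * ‖v‖ ^ 2 + 2 * (a ^ 2 * inner ℝ v z) + ‖z‖ ^ 2 := by
        rw [norm_add_sq_real, norm_smul, real_inner_smul_left, mul_pow, Real.norm_eq_abs, sq_abs]
    _ ≤ (a ^ 2) ^ 2 * 1 + 2 * (a ^ 2 * (δ * (a * b))) + (a * b) ^ 2 := by gcongr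
    _ = a ^ 2 * (1 + δ * (2 * (a * b))) := by linear_combination a ^ 2 * hab
    _ ≤ a ^ 2 * (1 + δ * 1) := by gcongr
    _ ≤ (a * t) ^ 2 := by rw [mul_one, mul_pow]; gcongr

/-- The linear map scaling the direction of `v` by `δ` and fixing the orthogonal complement of `v`.
It is the identity for `v = 0`. -/
noncomputable def scaleAlong (v : E) (δ : ℝ) : E →ₗ[ℝ] E :=
  LinearMap.transvection ((‖v‖ ^ 2)⁻¹ • innerₛₗ ℝ v) ((δ - 1) • v)

theorem scaleAlong_apply (v : E) (δ : ℝ) (z : E) :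
    scaleAlong v δ z = z + ((‖v‖ ^ 2)⁻¹ * inner ℝ v z * (δ - 1)) • v := by
  simp [scaleAlong, LinearMap.transvection.apply, smul_smul]

theorem inner_scaleAlong (v : E) (δ : ℝ) (z : E) :
    inner ℝ v (scaleAlong v δ z) = δ * inner ℝ v z := by
  rcases eq_or_ne v 0 with rfl | hv
  · simp
  rw [scaleAlong_apply, inner_add_right, real_inner_smul_right, real_inner_self_eq_norm_sq]
  field_simp
  ring

theorem norm_scaleAlong_le (v : E) {δ : ℝ} (hδ : 0 ≤ δ) (hδ1 : δ ≤ 1) (z : E) :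
    ‖scaleAlong v δ z‖ ≤ ‖z‖ := by
  rcases eq_or_ne v 0 with rfl | hv
  · simp [scaleAlong_apply]
  have hsq : ‖scaleAlong v δ z‖ ^ 2 = ‖z‖ ^ 2 - (1 - δ ^ 2) * (inner ℝ v z ^ 2 / ‖v‖ ^ 2) := by
    rw [scaleAlong_apply, norm_add_sq_real, real_inner_smul_right, real_inner_comm, norm_smul,
      mul_pow, Real.norm_eq_abs, sq_abs]
    field_simp
    ring
  refine le_of_sq_le_sq ?_ (norm_nonneg z)
  rw [hsq]
  exact sub_le_self _ (mul_nonneg (sub_nonneg.2 (pow_le_one₀ hδ hδ1)) (by positivity))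

variable [FiniteDimensional ℝ E]

theorem det_scaleAlong {v : E} (hv : v ≠ 0) (δ : ℝ) : LinearMap.det (scaleAlong v δ) = δ := by
  simp only [scaleAlong, LinearMap.transvection.det, LinearMap.smul_apply, map_smul,
    innerₛₗ_apply_apply, real_inner_self_eq_norm_sq, smul_eq_mul]
  field_simp
  ring

variable [MeasurableSpace E] [BorelSpace E] (ν : Measure E) [ν.IsAddHaarMeasure]

theorem mul_le_measureReal_slab (v : E) {δ r : ℝ} (hδ : 0 ≤ δ) (hδ1 : δ ≤ 1) (hr : 0 ≤ r) :
    δ * (r ^ finrank ℝ E * ν.real (ball 0 1)) ≤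
      ν.real {z | ‖z‖ ≤ r ∧ |inner ℝ v z| ≤ δ * (‖v‖ * r)} := by
  rcases eq_or_ne v 0 with rfl | hv
  · have hslab : {z : E | ‖z‖ ≤ r ∧ |inner ℝ (0 : E) z| ≤ δ * (‖(0 : E)‖ * r)} =
        closedBall 0 r := by
      ext z; simp
    rw [hslab, ← Measure.addHaar_real_closedBall ν 0 hr]
    exact mul_le_of_le_one_left measureReal_nonneg hδ1
  have himage : scaleAlong v δ '' closedBall 0 r ⊆
      {z | ‖z‖ ≤ r ∧ |inner ℝ v z| ≤ δ * (‖v‖ * r)} := by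
    rintro _ ⟨z, hz, rfl⟩
    rw [mem_closedBall_zero_iff] at hz
    refine ⟨(norm_scaleAlong_le v hδ hδ1 z).trans hz, ?_⟩
    rw [inner_scaleAlong, abs_mul, abs_of_nonneg hδ]
    gcongr
    exact (abs_real_inner_le_norm v z).trans (by gcongr)
  have hfinite : ν {z | ‖z‖ ≤ r ∧ |inner ℝ v z| ≤ δ * (‖v‖ * r)} ≠ ∞ :=
    ((measure_mono fun z hz => mem_closedBall_zero_iff.2 hz.1).trans_lt
      (measure_closedBall_lt_top (x := 0) (r := r))).ne
  calc δ * (r ^ finrank ℝ E * ν.real (ball 0 1)) = ν.real (scaleAlong v δ '' closedBall 0 r) := by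
        rw [measureReal_def ν (_ '' _), Measure.addHaar_image_linearMap, det_scaleAlong hv,
          ENNReal.toReal_mul, ENNReal.toReal_ofReal (abs_nonneg δ), abs_of_nonneg hδ,
          ← measureReal_def, Measure.addHaar_real_closedBall ν 0 hr]
    _ ≤ _ := measureReal_mono himage hfinite

theorem mul_le_measureReal_lens {a b δ t : ℝ} (ha : 0 ≤ a) (hb : 0 ≤ b)
    (hab : a ^ 2 + b ^ 2 = 1) (hδ : 0 ≤ δ) (hδ1 : δ ≤ 1) (ht : 0 ≤ t) (hδt : 1 + δ ≤ t ^ 2)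
    {v : E} (hv : ‖v‖ ≤ 1) :
    δ * ((a * b) ^ finrank ℝ E * ν.real (ball 0 1)) ≤
      ν.real (closedBall 0 (b * t) ∩ closedBall v (a * t)) := by
  have htranslate : (b ^ 2 • v + ·) '' {z | ‖z‖ ≤ a * b ∧ |inner ℝ v z| ≤ δ * (‖v‖ * (a * b))} ⊆
      closedBall 0 (b * t) ∩ closedBall v (a * t) := by
    rintro _ ⟨z, ⟨hz, hvz⟩, rfl⟩
    have hvz' : |inner ℝ v z| ≤ δ * (a * b) :=
      hvz.trans <| mul_le_mul_of_nonneg_left (mul_le_of_le_one_left (mul_nonneg ha hb) hv) hδ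
    refine ⟨mem_closedBall_zero_iff.2 ?_, mem_closedBall_iff_norm.2 ?_⟩
    · rw [mul_comm a b] at hz hvz'
      exact norm_sq_smul_add_le hb (by linarith) hδ ht hδt hv hz (abs_le.1 hvz').2
    · have hshift : b ^ 2 • v + z - v = a ^ 2 • -v + z := by
        rw [eq_sub_of_add_eq hab, smul_neg, sub_smul, one_smul]; abel
      rw [hshift]
      refine norm_sq_smul_add_le ha hab hδ ht hδt (by rwa [norm_neg]) hz ?_
      rw [inner_neg_left]
      linarith [(abs_le.1 hvz').1]
  calc δ * ((a * b) ^ finrank ℝ E * ν.real (ball 0 1))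
      ≤ ν.real {z | ‖z‖ ≤ a * b ∧ |inner ℝ v z| ≤ δ * (‖v‖ * (a * b))} :=
        mul_le_measureReal_slab ν v hδ hδ1 (by positivity)
    _ = ν.real ((b ^ 2 • v + ·) '' {z | ‖z‖ ≤ a * b ∧ |inner ℝ v z| ≤ δ * (‖v‖ * (a * b))}) := by
        rw [measureReal_def, measureReal_def, Set.image_add_left, measure_preimage_add]
    _ ≤ ν.real (closedBall 0 (b * t) ∩ closedBall v (a * t)) :=
        measureReal_mono htranslate
          ((measure_mono Set.inter_subset_left).trans_lt measure_closedBall_lt_top).ne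

end Lens

section BallCover

open MeasureTheory Metric Module

variable {E : Type*} [NormedAddCommGroup E] [InnerProductSpace ℝ E] [FiniteDimensional ℝ E]

theorem exists_finset_cover_finset_unitBall {a δ t : ℝ} (ha : 0 < a) (ha1 : a < 1)
    (hδ : 0 < δ) (hδ1 : δ ≤ 1) (ht : 0 ≤ t) (hδt : 1 + δ ≤ t ^ 2)
    {V : Finset E} (hV : ∀ v ∈ V, ‖v‖ ≤ 1) {L : ℝ} (hL : 0 ≤ L) :
    ∃ S : Finset E, (S.card : ℝ) ≤
        L / (δ * (a / t) ^ finrank ℝ E) + 1 + Real.exp (-L) * V.card ∧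
      ∀ v ∈ V, ∃ c ∈ S, ‖v - c‖ ≤ a * t := by
  borelize E
  let ν : Measure E := Measure.addHaar
  let b : ℝ := √(1 - a ^ 2)
  have ha2 : 0 < 1 - a ^ 2 := sub_pos.2 (pow_lt_one₀ ha.le ha1 two_ne_zero)
  have hb : 0 < b := Real.sqrt_pos.2 ha2
  have hab : a ^ 2 + b ^ 2 = 1 := by rw [Real.sq_sqrt ha2.le]; ring
  have ht0 : 0 < t := ht.lt_of_ne' (by rintro rfl; linarith [hδt.trans_eq (zero_pow two_ne_zero)])
  let B : Set E := closedBall 0 (b * t)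
  have hB : 0 < ν.real B := by
    rw [Measure.addHaar_real_closedBall ν 0 (by positivity)]
    exact mul_pos (by positivity) (measureReal_unitBall_pos ν)
  have : IsProbabilityMeasure (ProbabilityTheory.cond ν B) :=
    ProbabilityTheory.cond_isProbabilityMeasure_of_finite (ENNReal.toReal_pos_iff.1 hB).1.ne'
      measure_closedBall_lt_top.ne
  have hlens : ∀ v ∈ V, δ * (a / t) ^ finrank ℝ E ≤
      (ProbabilityTheory.cond ν B).real (closedBall v (a * t)) := by
    intro v hv
    rw [measureReal_def, ProbabilityTheory.cond_apply measurableSet_closedBall,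
      ENNReal.toReal_mul, ENNReal.toReal_inv, ← measureReal_def, ← measureReal_def,
      le_inv_mul_iff₀ hB]
    refine le_trans (le_of_eq ?_)
      (mul_le_measureReal_lens ν ha.le hb.le hab hδ.le hδ1 ht hδt (hV v hv))
    rw [Measure.addHaar_real_closedBall ν 0 (by positivity), div_pow, mul_pow, mul_pow]
    field_simp
  obtain ⟨S, hcard, hS⟩ := exists_finset_hitting (fun _ _ => measurableSet_closedBall)
    (by positivity) hlens hL
  refine ⟨S, hcard, fun v hv => ?_⟩
  obtain ⟨c, hc, hcv⟩ := hS v hv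
  exact ⟨c, hc, by rwa [mem_closedBall', dist_eq_norm] at hcv⟩

theorem one_add_inv_mul_pow_le_eight {n : ℕ} (hn : 0 < n) :
    ((1 + 1 / (n : ℝ)) * (1 + 1 / (2 * n))) ^ n ≤ 8 := by
  have hn' : (0 : ℝ) < n := Nat.cast_pos.2 hn
  calc ((1 + 1 / (n : ℝ)) * (1 + 1 / (2 * n))) ^ n
      ≤ (Real.exp (1 / n) * Real.exp (1 / n)) ^ n := by
        have hhalf : 1 / (2 * n : ℝ) ≤ 1 / n := by gcongr; linarith
        gcongr
        · linarith [Real.add_one_le_exp (1 / (n : ℝ))]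
        · linarith [Real.add_one_le_exp (1 / (n : ℝ))]
    _ = Real.exp 1 ^ 2 := by
        rw [← Real.exp_add, ← Real.exp_nat_mul, ← Real.exp_nat_mul]
        congr 1
        field_simp
        norm_num
    _ ≤ 2.72 ^ 2 := by gcongr; linarith [Real.exp_one_lt_d9]
    _ ≤ 8 := by norm_num

theorem div_lensFraction_le {n : ℕ} (hn : 0 < n) {s : ℝ} (hs : 0 < s) :
    9 * (n : ℝ) ^ 2 / (1 / n * (s / (1 + 1 / n) / (1 + 1 / (2 * n))) ^ n) ≤
      72 * n ^ 3 / s ^ n := by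
  calc 9 * (n : ℝ) ^ 2 / (1 / n * (s / (1 + 1 / n) / (1 + 1 / (2 * n))) ^ n)
      = 9 * n ^ 3 * ((1 + 1 / (n : ℝ)) * (1 + 1 / (2 * n))) ^ n / s ^ n := by
        rw [div_div, div_pow]
        have hpos : 0 < ((1 + 1 / (n : ℝ)) * (1 + 1 / (2 * n))) ^ n := by positivity
        generalize ((1 + 1 / (n : ℝ)) * (1 + 1 / (2 * n))) ^ n = q at hpos ⊢
        field_simp
    _ ≤ 9 * n ^ 3 * 8 / s ^ n := by gcongr; exact one_add_inv_mul_pow_le_eight hn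
    _ = 72 * n ^ 3 / s ^ n := by ring

theorem exp_neg_mul_pow_le {n : ℕ} {s : ℝ} (hs : 0 < s) (hs1 : s ≤ 1) :
    Real.exp (-(9 * n ^ 2)) * (1 + 2 / (s / (4 * n))) ^ n ≤ 1 / s ^ n := by
  have hbase : 1 + 2 / (s / (4 * n)) ≤ Real.exp (9 * n) / s := by
    rw [le_div_iff₀ hs]
    calc (1 + 2 / (s / (4 * n))) * s = s + 8 * n := by field_simp; ring
      _ ≤ 1 + 9 * n := by gcongr; norm_num
      _ ≤ Real.exp (9 * n) := by linarith [Real.add_one_le_exp (9 * n : ℝ)]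
  calc Real.exp (-(9 * n ^ 2)) * (1 + 2 / (s / (4 * n))) ^ n
      ≤ Real.exp (-(9 * n ^ 2)) * (Real.exp (9 * n) / s) ^ n := by gcongr
    _ = 1 / s ^ n := by
        rw [div_pow, ← Real.exp_nat_mul, mul_div_assoc', ← Real.exp_add,
          show -(9 * (n : ℝ) ^ 2) + n * (9 * n) = 0 by ring, Real.exp_zero]

theorem exists_finset_cover_unitBall [Nontrivial E] {s : ℝ} (hs : 0 < s) (hs1 : s ≤ 1) :
    ∃ S : Finset E, (S.card : ℝ) ≤ 74 * finrank ℝ E ^ 3 / s ^ finrank ℝ E ∧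
      ∀ x : E, ‖x‖ ≤ 1 → ∃ c ∈ S, ‖x - c‖ ≤ s := by
  set n := finrank ℝ E
  have hn0 : 0 < n := finrank_pos
  have hn1 : (1 : ℝ) ≤ n := Nat.one_le_cast.2 hn0
  set u : ℝ := 1 + 1 / n with hu
  set t : ℝ := 1 + 1 / (2 * n) with ht
  have hu1 : 1 < u := lt_add_of_pos_right 1 (by positivity)
  have hδt : 1 + 1 / (n : ℝ) ≤ t ^ 2 := by
    have hsq : t ^ 2 = 1 + 1 / n + (1 / (2 * n)) ^ 2 := by rw [ht]; field_simp; ring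
    exact hsq ▸ le_add_of_nonneg_right (sq_nonneg _)
  obtain ⟨V, hV, hnet, hVcard⟩ :=
    exists_finset_net_unitBall (E := E) (r := s / (4 * n)) (by positivity)
  obtain ⟨S, hScard, hS⟩ := exists_finset_cover_finset_unitBall (a := s / u) (L := 9 * n ^ 2)
    (by positivity) ((div_lt_one (by positivity)).2 (hs1.trans_lt hu1))
    (by positivity : 0 < 1 / (n : ℝ)) ((div_le_one (by positivity)).2 hn1) (by positivity) hδt hV
    (by positivity)
  refine ⟨S, hScard.trans ?_, fun x hx => ?_⟩
  · have hgreedy : 9 * n ^ 2 / (1 / n * (s / u / t) ^ n) ≤ 72 * n ^ 3 / s ^ n :=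
      div_lensFraction_le hn0 hs
    have hmissed : Real.exp (-(9 * n ^ 2)) * V.card ≤ n ^ 3 / s ^ n :=
      (mul_le_mul_of_nonneg_left hVcard (Real.exp_pos _).le).trans <|
        (exp_neg_mul_pow_le hs hs1).trans (by gcongr; exact one_le_pow₀ hn1)
    have hone : 1 ≤ n ^ 3 / s ^ n := by
      rw [one_le_div (by positivity)]
      exact (pow_le_one₀ hs.le hs1).trans (one_le_pow₀ hn1)
    calc 9 * n ^ 2 / (1 / n * (s / u / t) ^ n) + 1 + Real.exp (-(9 * n ^ 2)) * V.card
        ≤ 72 * n ^ 3 / s ^ n + n ^ 3 / s ^ n + n ^ 3 / s ^ n := by gcongr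
      _ = 74 * n ^ 3 / s ^ n := by ring
  · obtain ⟨v, hv, hxv⟩ := hnet x hx
    obtain ⟨c, hc, hvc⟩ := hS v hv
    have hradius : s / (4 * n) + s / u * t ≤ s := by
      rw [hu, ht]
      field_simp
      nlinarith
    exact ⟨c, hc, (norm_sub_le_norm_sub_add_norm_sub x v c).trans
      ((add_le_add hxv hvc).trans hradius)⟩

end BallCover

section Scales

variable {E F : Type*} [NormedAddCommGroup E] [NormedSpace ℝ E] [NormedAddCommGroup F]
  [NormedSpace ℝ F]

theorem exists_finset_cover_scales {A : E →ₗ[ℝ] F} {S : Finset E} {ρ : ℝ}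
    (hS : ∀ x, ‖A x‖ ≤ 1 → ∃ c ∈ S, ‖x - c‖ ≤ ρ) {T : Finset ℝ} (hT : ∀ r ∈ T, 0 < r) :
    ∃ S' : Finset E, S'.card ≤ T.card * S.card ∧
      ∀ r ∈ T, ∀ x, ‖A x‖ ≤ r → ∃ c ∈ S', ‖x - c‖ ≤ r * ρ := by
  classical
  refine ⟨Finset.image₂ (· • ·) T S, Finset.card_image₂_le _ _ _, fun r hr x hx => ?_⟩
  have hr0 := hT r hr
  obtain ⟨c, hc, hxc⟩ := hS (r⁻¹ • x) (by
    rwa [map_smul, norm_smul, norm_inv, Real.norm_of_nonneg hr0.le, inv_mul_le_one₀ hr0])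
  refine ⟨r • c, Finset.mem_image₂_of_mem hr hc, ?_⟩
  calc ‖x - r • c‖ = ‖r • (r⁻¹ • x - c)‖ := by rw [smul_sub, smul_inv_smul₀ hr0.ne']
    _ = r * ‖r⁻¹ • x - c‖ := by rw [norm_smul, Real.norm_of_nonneg hr0.le]
    _ ≤ r * ρ := by gcongr

theorem exists_finset_scales {τ : ℝ} (hτ : 0 < τ) (hτ1 : τ ≤ 1) :
    ∃ T : Finset ℝ, (∀ r ∈ T, 0 < r) ∧ (T.card : ℝ) ≤ 5 / τ ^ 2 ∧
      ∀ a, 0 ≤ a → a ≤ 1 → ∃ r ∈ T, a ≤ r ∧ r ^ 2 ≤ a ^ 2 + τ ^ 2 := by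
  have hτ2 : 1 ≤ 1 / τ ^ 2 := (one_le_div (by positivity)).2 (pow_le_one₀ hτ.le hτ1)
  have hthree : 3 / τ ^ 2 = 3 * (1 / τ ^ 2) := by ring
  obtain ⟨M, hM, hM'⟩ : ∃ M : ℕ, 3 / τ ^ 2 ≤ M ∧ (M : ℝ) < 3 / τ ^ 2 + 1 :=
    ⟨_, Nat.le_ceil _, Nat.ceil_lt_add_one (by positivity)⟩
  have hM3 : (3 : ℝ) ≤ M := by linarith
  have hM0 : (0 : ℝ) < M := by linarith
  refine ⟨(Finset.range (M + 1)).image fun i : ℕ => ((i : ℝ) + 1) / M, ?_, ?_, ?_⟩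
  · simp only [Finset.forall_mem_image]
    exact fun i _ => by positivity
  · calc _ ≤ ((Finset.range (M + 1)).card : ℝ) := by exact_mod_cast Finset.card_image_le
      _ = M + 1 := by rw [Finset.card_range, Nat.cast_add_one]
      _ ≤ 5 * (1 / τ ^ 2) := by linarith
      _ = 5 / τ ^ 2 := by ring
  · intro a ha ha1
    have hle : (⌊a * M⌋₊ : ℝ) ≤ a * M := Nat.floor_le (by positivity)
    have hlt : a * M < ⌊a * M⌋₊ + 1 := Nat.lt_floor_add_one _
    have hfloor : ⌊a * M⌋₊ < M + 1 :=
      Nat.lt_add_one_of_le (Nat.floor_le_of_le (mul_le_of_le_one_left hM0.le ha1))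
    refine ⟨_, Finset.mem_image_of_mem _ (Finset.mem_range.2 hfloor),
      (le_div_iff₀ hM0).2 hlt.le, ?_⟩
    have hupper : ((⌊a * M⌋₊ : ℝ) + 1) / M ≤ a + 1 / M := by
      rw [div_le_iff₀ hM0, add_mul, one_div_mul_cancel hM0.ne']
      linarith
    have hinv : 1 / (M : ℝ) ≤ 1 := (div_le_one hM0).2 (by linarith)
    have hinv0 : 0 ≤ 1 / (M : ℝ) := by positivity
    have hinvτ : 3 * (1 / (M : ℝ)) ≤ τ ^ 2 := by
      rw [mul_one_div]
      exact (div_le_comm₀ hM0 (by positivity)).2 hM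
    calc (((⌊a * M⌋₊ : ℝ) + 1) / M) ^ 2 ≤ (a + 1 / M) ^ 2 := by gcongr
      _ ≤ a ^ 2 + 3 * (1 / M) := by nlinarith
      _ ≤ a ^ 2 + τ ^ 2 := by gcongr

end Scales

section GradedBallCover

open Module

variable {E : Type*} [NormedAddCommGroup E] [InnerProductSpace ℝ E] [FiniteDimensional ℝ E]

theorem exists_finset_graded_cover_unitBall [Nontrivial E] {s τ : ℝ} (hs : 0 < s) (hs1 : s ≤ 1)
    (hτ : 0 < τ) (hτ1 : τ ≤ 1) :
    ∃ S : Finset E, (S.card : ℝ) ≤ 370 * finrank ℝ E ^ 3 / τ ^ 2 / s ^ finrank ℝ E ∧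
      ∀ x : E, ‖x‖ ≤ 1 → ∃ c ∈ S, ‖x - c‖ ^ 2 ≤ s ^ 2 * (‖x‖ ^ 2 + τ ^ 2) := by
  obtain ⟨S, hcard, hS⟩ := exists_finset_cover_unitBall (E := E) hs hs1
  obtain ⟨T, hT0, hTcard, hT⟩ := exists_finset_scales hτ hτ1
  obtain ⟨S', hcard', hS'⟩ := exists_finset_cover_scales (A := LinearMap.id) hS hT0
  refine ⟨S', ?_, fun x hx => ?_⟩
  · calc (S'.card : ℝ) ≤ T.card * S.card := by exact_mod_cast hcard'
      _ ≤ 5 / τ ^ 2 * (74 * finrank ℝ E ^ 3 / s ^ finrank ℝ E) := by gcongr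
      _ = _ := by ring
  · obtain ⟨r, hr, hxr, hrτ⟩ := hT ‖x‖ (norm_nonneg x) hx
    obtain ⟨c, hc, hxc⟩ := hS' r hr x hxr
    refine ⟨c, hc, ?_⟩
    calc ‖x - c‖ ^ 2 ≤ (r * s) ^ 2 := by gcongr
      _ = s ^ 2 * r ^ 2 := by ring
      _ ≤ _ := by gcongr

end GradedBallCover

section FiniteEllipsoid

variable {ι : Type*} [Fintype ι] [DecidableEq ι]

/-- The diagonal map dividing the `i`-th coordinate by `m i`, so that `‖coordDiv m y‖ ≤ 1`
describes the ellipsoid with semi-axes `m`. -/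
noncomputable def coordDiv (m : ι → ℝ) : EuclideanSpace ℝ ι →ₗ[ℝ] EuclideanSpace ℝ ι :=
  Matrix.toLpLin 2 2 (Matrix.diagonal fun i => (m i)⁻¹)

theorem coordDiv_apply (m : ι → ℝ) (y : EuclideanSpace ℝ ι) (i : ι) :
    coordDiv m y i = y i / m i := by
  simp [coordDiv, Matrix.mulVec_diagonal, div_eq_inv_mul]

theorem norm_coordDiv_sq (m : ι → ℝ) (y : EuclideanSpace ℝ ι) :
    ‖coordDiv m y‖ ^ 2 = ∑ i, (y i / m i) ^ 2 := by
  rw [EuclideanSpace.real_norm_sq_eq]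
  simp only [coordDiv_apply]

theorem det_coordDiv (m : ι → ℝ) : LinearMap.det (coordDiv m) = ∏ i, (m i)⁻¹ := by
  rw [coordDiv, Matrix.toLpLin_eq_toLin, LinearMap.det_toLin, Matrix.det_diagonal]

theorem det_coordDiv_ne_zero {m : ι → ℝ} (hm : ∀ i, 0 < m i) :
    LinearMap.det (coordDiv m) ≠ 0 := by
  rw [det_coordDiv]
  exact Finset.prod_ne_zero_iff.2 fun i _ => inv_ne_zero (hm i).ne'

theorem inv_abs_det_coordDiv {m : ι → ℝ} (hm : ∀ i, 0 < m i) :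
    |LinearMap.det (coordDiv m)|⁻¹ = ∏ i, m i := by
  rw [det_coordDiv, Finset.prod_inv_distrib, abs_inv, inv_inv,
    abs_of_pos (Finset.prod_pos fun i _ => hm i)]

theorem mul_norm_coordDiv_le {m : ι → ℝ} {ε : ℝ} (hε : 0 < ε) (hm : ∀ i, ε ≤ m i)
    (y : EuclideanSpace ℝ ι) : ε * ‖coordDiv m y‖ ≤ ‖y‖ := by
  refine le_of_sq_le_sq ?_ (norm_nonneg y)
  rw [mul_pow, norm_coordDiv_sq, EuclideanSpace.real_norm_sq_eq, Finset.mul_sum]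
  refine Finset.sum_le_sum fun i _ => ?_
  have hmi : 0 < m i := hε.trans_le (hm i)
  rw [div_pow, mul_div_left_comm]
  exact mul_le_of_le_one_right (sq_nonneg _)
    ((div_le_one (by positivity)).2 (pow_le_pow_left₀ hε.le (hm i) 2))

theorem prod_semiAxes_le_card_mul_pow {m : ι → ℝ} (hm : ∀ i, 0 < m i)
    {S : Finset (EuclideanSpace ℝ ι)} {ρ : ℝ} (hρ : 0 ≤ ρ)
    (hS : ∀ y, ‖coordDiv m y‖ ≤ 1 → ∃ c ∈ S, ‖y - c‖ ≤ ρ) :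
    ∏ i, m i ≤ S.card * ρ ^ Fintype.card ι := by
  rw [← inv_abs_det_coordDiv hm, ← finrank_euclideanSpace (𝕜 := ℝ) (ι := ι)]
  exact inv_abs_det_le_card_mul_pow (det_coordDiv_ne_zero hm) hρ hS

theorem exists_finset_half_net_ellipsoid {m : ι → ℝ} {ε : ℝ} (hε : 0 < ε) (hm : ∀ i, ε ≤ m i) :
    ∃ S : Finset (EuclideanSpace ℝ ι), S.card * ε ^ Fintype.card ι ≤
        5 ^ Fintype.card ι * ∏ i, m i ∧
      ∀ y, ‖coordDiv m y‖ ≤ 1 → ∃ c ∈ S, ‖y - c‖ ≤ ε / 2 := by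
  have hm0 : ∀ i, 0 < m i := fun i => hε.trans_le (hm i)
  obtain ⟨S, -, hS, hcard⟩ := exists_finset_net_norm_map_le (det_coordDiv_ne_zero hm0) hε
    (half_pos hε) (mul_norm_coordDiv_le hε hm)
  refine ⟨S, ?_, hS⟩
  rw [inv_abs_det_coordDiv hm0, finrank_euclideanSpace] at hcard
  have hratio : 4 * (1 + ε / 2 / (2 * ε)) = 5 := by field_simp; norm_num
  calc S.card * ε ^ Fintype.card ι
      = 4 ^ Fintype.card ι * (S.card * (ε / 2 / 2) ^ Fintype.card ι) := by
        rw [mul_left_comm, ← mul_pow]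
        ring_nf
    _ ≤ 4 ^ Fintype.card ι * ((∏ i, m i) * (1 + ε / 2 / (2 * ε)) ^ Fintype.card ι) := by gcongr
    _ = _ := by rw [mul_left_comm, ← mul_pow, hratio, mul_comm]

theorem exists_dyadic_scale {a : ℝ} (ha : a ≤ 1) (m : ℕ) :
    ∃ i ≤ m, a ≤ (1 / 2) ^ i ∧ (1 / 2 : ℝ) ^ i ≤ max (2 * a) ((1 / 2) ^ m) := by
  induction m with
  | zero => exact ⟨0, le_rfl, by simpa using ha, le_max_right _ _⟩
  | succ m ih =>
    obtain ⟨i, him, hai, hi⟩ := ih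
    rcases le_or_gt a ((1 / 2) ^ (m + 1)) with h | h
    · exact ⟨m + 1, le_rfl, h, le_max_right _ _⟩
    · refine ⟨i, by omega, hai, hi.trans (max_le (le_max_left _ _) (le_max_of_le_left ?_))⟩
      rw [pow_succ] at h
      linarith

theorem exists_finset_graded_cover_ellipsoid {μ : ι → ℝ} {ε : ℝ} (hε : 0 < ε)
    (hμ : ∀ i, ε ≤ μ i) (m : ℕ) :
    ∃ S : Finset (EuclideanSpace ℝ ι), S.card * ε ^ Fintype.card ι ≤
        (m + 1) * (5 ^ Fintype.card ι * ∏ i, μ i) ∧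
      ∀ y, ‖coordDiv μ y‖ ≤ 1 →
        ∃ c ∈ S, ‖y - c‖ ^ 2 ≤ ε ^ 2 * (‖coordDiv μ y‖ ^ 2 + ((1 / 2) ^ m) ^ 2) := by
  obtain ⟨S, hcard, hS⟩ := exists_finset_half_net_ellipsoid hε hμ
  obtain ⟨S', hcard', hS'⟩ := exists_finset_cover_scales hS
    (T := (Finset.range (m + 1)).image fun i => (1 / 2 : ℝ) ^ i)
    (by simp only [Finset.forall_mem_image]; exact fun i _ => by positivity)
  refine ⟨S', ?_, fun y hy => ?_⟩
  · have hscales : ((Finset.range (m + 1)).image fun i => (1 / 2 : ℝ) ^ i).card ≤ m + 1 :=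
      Finset.card_image_le.trans_eq (Finset.card_range _)
    calc (S'.card : ℝ) * ε ^ Fintype.card ι
        ≤ ((m + 1) * S.card) * ε ^ Fintype.card ι := by
          gcongr
          exact_mod_cast hcard'.trans (Nat.mul_le_mul_right _ hscales)
      _ = (m + 1) * (S.card * ε ^ Fintype.card ι) := mul_assoc _ _ _
      _ ≤ _ := by gcongr
  · obtain ⟨i, him, hyi, hi⟩ := exists_dyadic_scale hy m
    obtain ⟨c, hc, hyc⟩ := hS' _ (Finset.mem_image_of_mem _ (Finset.mem_range_succ_iff.2 him)) y hyi
    refine ⟨c, hc, ?_⟩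
    have hscale : (((1 : ℝ) / 2) ^ i / 2) ^ 2 ≤ ‖coordDiv μ y‖ ^ 2 + ((1 / 2) ^ m) ^ 2 := by
      have hm : (0 : ℝ) ≤ (1 / 2) ^ m := by positivity
      have hi0 : (0 : ℝ) ≤ (1 / 2) ^ i := by positivity
      rcases le_max_iff.1 hi with h | h <;> nlinarith [sq_nonneg ‖coordDiv μ y‖]
    calc ‖y - c‖ ^ 2 ≤ ((1 / 2) ^ i * (ε / 2)) ^ 2 := by gcongr
      _ = ε ^ 2 * ((1 / 2) ^ i / 2) ^ 2 := by ring
      _ ≤ _ := by gcongr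

end FiniteEllipsoid

section BlockCover

open Module

theorem exists_finset_graded_cover_ball {E : Type*} [NormedAddCommGroup E] [InnerProductSpace ℝ E]
    [FiniteDimensional ℝ E] [Nontrivial E] {R ε τ : ℝ} (hε : 0 < ε) (hR : ε ≤ R) (hτ : 0 < τ)
    (hτ1 : τ ≤ 1) :
    ∃ S : Finset E,
      (S.card : ℝ) ≤ 370 * finrank ℝ E ^ 3 / τ ^ 2 * (R / ε) ^ finrank ℝ E ∧
      ∀ x : E, ‖x‖ ≤ R → ∃ c ∈ S, ‖x - c‖ ^ 2 ≤ ε ^ 2 * ((‖x‖ / R) ^ 2 + τ ^ 2) := by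
  classical
  have hR0 : 0 < R := hε.trans_le hR
  obtain ⟨S, hcard, hS⟩ := exists_finset_graded_cover_unitBall (E := E) (div_pos hε hR0)
    ((div_le_one hR0).2 hR) hτ hτ1
  rw [div_eq_mul_inv _ ((ε / R) ^ finrank ℝ E), ← inv_pow, inv_div] at hcard
  refine ⟨S.image (R • ·), le_trans (by exact_mod_cast Finset.card_image_le) hcard,
    fun x hx => ?_⟩
  have hnorm : ‖R⁻¹ • x‖ = ‖x‖ / R := by
    rw [norm_smul, norm_inv, Real.norm_of_nonneg hR0.le, inv_mul_eq_div]
  obtain ⟨c, hc, hxc⟩ := hS (R⁻¹ • x) (hnorm ▸ (div_le_one hR0).2 hx)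
  refine ⟨R • c, Finset.mem_image_of_mem _ hc, ?_⟩
  calc ‖x - R • c‖ ^ 2 = R ^ 2 * ‖R⁻¹ • x - c‖ ^ 2 := by
        rw [← Real.norm_of_nonneg hR0.le, ← mul_pow, ← norm_smul, Real.norm_of_nonneg hR0.le,
          smul_sub, smul_inv_smul₀ hR0.ne']
    _ ≤ R ^ 2 * ((ε / R) ^ 2 * (‖R⁻¹ • x‖ ^ 2 + τ ^ 2)) := by gcongr
    _ = ε ^ 2 * ((‖x‖ / R) ^ 2 + τ ^ 2) := by rw [hnorm, ← mul_assoc, ← mul_pow,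
          mul_div_cancel₀ _ hR0.ne']

theorem exists_finset_cover_piLp {κ : Type*} [Fintype κ] {E : κ → Type*}
    [∀ j, SeminormedAddCommGroup (E j)] {S : ∀ j, Finset (E j)} {f R : ∀ j, E j → ℝ}
    (hS : ∀ j x, R j x ≤ 1 → ∃ c ∈ S j, ‖x - c‖ ^ 2 ≤ f j x) :
    ∃ T : Finset (PiLp 2 E), T.card = ∏ j, (S j).card ∧
      ∀ x : PiLp 2 E, (∀ j, R j (x j) ≤ 1) → ∃ c ∈ T, ‖x - c‖ ^ 2 ≤ ∑ j, f j (x j) := by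
  classical
  refine ⟨(Fintype.piFinset S).map ⟨WithLp.toLp 2, WithLp.toLp_injective 2⟩, ?_, fun x hx => ?_⟩
  · rw [Finset.card_map, Fintype.card_piFinset]
  · choose c hc hxc using fun j => hS j (x j) (hx j)
    refine ⟨WithLp.toLp 2 c, Finset.mem_map_of_mem _ (Fintype.mem_piFinset.2 hc), ?_⟩
    rw [PiLp.norm_sq_eq_of_L2]
    exact Finset.sum_le_sum fun j _ => hxc j

variable {κ : Type*} [Fintype κ] [DecidableEq κ] {β : κ → Type*} [∀ j, Fintype (β j)]
  [∀ j, DecidableEq (β j)]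

theorem norm_coordDiv_sigma_sq (μ : κ → ℝ) (y : EuclideanSpace ℝ (Σ j, β j)) :
    ‖coordDiv (fun i : Σ j, β j => μ i.1) y‖ ^ 2 =
      ∑ j, (‖LinearIsometryEquiv.piLpCurry ℝ 2 (fun j (_ : β j) => ℝ) y j‖ / μ j) ^ 2 := by
  rw [norm_coordDiv_sq, Fintype.sum_sigma]
  refine Finset.sum_congr rfl fun j _ => ?_
  rw [div_pow, PiLp.norm_sq_eq_of_L2, Finset.sum_div]
  exact Finset.sum_congr rfl fun i _ => by
    rw [div_pow, Real.norm_eq_abs, sq_abs]; rfl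

theorem exists_finset_block_cover_ellipsoid [∀ j, Nonempty (β j)] {μ : κ → ℝ} {ε τ : ℝ}
    (hε : 0 < ε) (hμ : ∀ j, ε ≤ μ j) (hτ : 0 < τ) (hτ1 : τ ≤ 1) :
    ∃ S : Finset (EuclideanSpace ℝ (Σ j, β j)),
      (S.card : ℝ) ≤ ∏ j, (370 * Fintype.card (β j) ^ 3 / τ ^ 2 *
        (μ j / ε) ^ Fintype.card (β j)) ∧
      ∀ y, ‖coordDiv (fun i : Σ j, β j => μ i.1) y‖ ≤ 1 → ∃ c ∈ S, ‖y - c‖ ^ 2 ≤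
        ε ^ 2 * (‖coordDiv (fun i : Σ j, β j => μ i.1) y‖ ^ 2 + Fintype.card κ * τ ^ 2) := by
  classical
  have hμ0 : ∀ j, 0 < μ j := fun j => hε.trans_le (hμ j)
  choose S hScard hS using fun j =>
    exists_finset_graded_cover_ball (E := EuclideanSpace ℝ (β j)) hε (hμ j) hτ hτ1
  simp only [finrank_euclideanSpace] at hScard
  obtain ⟨T, hTcard, hT⟩ := exists_finset_cover_piLp (R := fun j x => ‖x‖ / μ j)
    fun j x hx => hS j x ((div_le_one (hμ0 j)).1 hx)
  let curry := LinearIsometryEquiv.piLpCurry ℝ 2 (fun j (_ : β j) => ℝ)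
  refine ⟨T.image curry.symm, ?_, fun y hy => ?_⟩
  · calc ((T.image curry.symm).card : ℝ) ≤ T.card := by exact_mod_cast Finset.card_image_le
      _ = ∏ j, ((S j).card : ℝ) := by rw [hTcard, Nat.cast_prod]
      _ ≤ _ := Finset.prod_le_prod (fun _ _ => by positivity) fun j _ => hScard j
  · have hblock : ∀ j, ‖curry y j‖ / μ j ≤ 1 := by
      intro j
      refine le_of_sq_le_sq ?_ zero_le_one
      calc (‖curry y j‖ / μ j) ^ 2 ≤ ∑ j, (‖curry y j‖ / μ j) ^ 2 :=
            Finset.single_le_sum (f := fun j => (‖curry y j‖ / μ j) ^ 2)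
              (fun _ _ => sq_nonneg _) (Finset.mem_univ j)
        _ ≤ 1 ^ 2 := by rw [← norm_coordDiv_sigma_sq]; gcongr
    obtain ⟨c, hc, hyc⟩ := hT (curry y) hblock
    refine ⟨curry.symm c, Finset.mem_image_of_mem _ hc, ?_⟩
    calc ‖y - curry.symm c‖ ^ 2 = ‖curry y - c‖ ^ 2 := by
          rw [← curry.norm_map, map_sub, curry.apply_symm_apply]
      _ ≤ ∑ j, ε ^ 2 * ((‖curry y j‖ / μ j) ^ 2 + τ ^ 2) := hyc
      _ = _ := by
        rw [← Finset.mul_sum, Finset.sum_add_distrib, Finset.sum_const, Finset.card_univ,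
          nsmul_eq_mul, norm_coordDiv_sigma_sq]

end BlockCover

section BlockSpace

open Metric

variable {d : ℕ → ℕ} {μ : ℕ → ℝ} {k : ℕ}

theorem hasSum_norm_sq_blockSpace (x : BlockSpace d) :
    HasSum (fun j => ‖x j‖ ^ 2) (‖x‖ ^ 2) := by
  simpa using lp.hasSum_norm (p := 2) (by norm_num) x

theorem mem_mixedEllipsoid_iff {x : BlockSpace d} :
    x ∈ mixedEllipsoid d μ ↔
      Summable (fun j => (‖x j‖ / μ j) ^ 2) ∧ ∑' j, (‖x j‖ / μ j) ^ 2 ≤ 1 := by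
  have hnonneg : ∀ j, 0 ≤ (‖x j‖ / μ j) ^ 2 := fun j => sq_nonneg _
  have hmem : x ∈ mixedEllipsoid d μ ↔ ∑' j, ENNReal.ofReal ((‖x j‖ / μ j) ^ 2) ≤ 1 := by
    change (∑' j, ENNReal.ofReal ((‖x j‖ / μ j) ^ 2)) ^ (1 / 2 : ℝ) ≤ 1 ↔ _
    conv_lhs => rw [← ENNReal.one_rpow (1 / 2 : ℝ)]
    exact ENNReal.rpow_le_rpow_iff (by norm_num)
  rw [hmem]
  constructor
  · intro h
    have hs : Summable (fun j => (‖x j‖ / μ j) ^ 2) := by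
      simpa only [ENNReal.toReal_ofReal (hnonneg _)] using
        ENNReal.summable_toReal (ne_top_of_le_ne_top ENNReal.one_ne_top h)
    rw [← ENNReal.ofReal_tsum_of_nonneg hnonneg hs] at h
    exact ⟨hs, ENNReal.ofReal_le_one.1 h⟩
  · rintro ⟨hs, h⟩
    rw [← ENNReal.ofReal_tsum_of_nonneg hnonneg hs]
    exact ENNReal.ofReal_le_one.2 h

/-- The Euclidean space `ℝ^{d₁} × ⋯ × ℝ^{d_k}` of the first `k` blocks. -/
abbrev HeadSpace (d : ℕ → ℕ) (k : ℕ) : Type :=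
  EuclideanSpace ℝ (Σ j : Fin k, Fin (d j))

/-- Division of the first `k` blocks by their semi-axes: `‖headDiv d μ k y‖` is the mixed ellipsoid
norm of a vector supported on these blocks. -/
noncomputable abbrev headDiv (d : ℕ → ℕ) (μ : ℕ → ℝ) (k : ℕ) : HeadSpace d k →ₗ[ℝ] HeadSpace d k :=
  coordDiv fun i => μ i.1

/-- The projection of a block sequence onto its first `k` blocks. -/
def headProj (k : ℕ) : BlockSpace d →ₗ[ℝ] HeadSpace d k where
  toFun x := WithLp.toLp 2 fun i => x i.1 i.2
  map_add' _ _ := rfl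
  map_smul' _ _ := rfl

/-- The extension by zero of the first `k` blocks to a block sequence, a right inverse of
`headProj`. -/
def headEmb (k : ℕ) (y : HeadSpace d k) : BlockSpace d :=
  ⟨fun j => if h : j < k then WithLp.toLp 2 fun i => y ⟨⟨j, h⟩, i⟩ else 0,
    (memℓp_zero ((Set.finite_lt_nat k).subset fun _ hj =>
      not_not.1 fun h => hj (dif_neg h))).of_exponent_ge bot_le⟩

theorem headEmb_apply_of_le (y : HeadSpace d k) {j : ℕ} (h : k ≤ j) : headEmb k y j = 0 :=
  dif_neg h.not_gt

theorem headProj_headEmb (y : HeadSpace d k) : headProj k (headEmb k y) = y := by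
  ext ⟨j, i⟩
  change headEmb k y j i = y ⟨j, i⟩
  rw [show headEmb k y j = WithLp.toLp 2 fun i => y ⟨j, i⟩ from dif_pos j.2]

theorem norm_headProj_sq (k : ℕ) (x : BlockSpace d) :
    ‖headProj k x‖ ^ 2 = ∑ j ∈ Finset.range k, ‖x j‖ ^ 2 := by
  rw [EuclideanSpace.real_norm_sq_eq, Fintype.sum_sigma, Finset.sum_range]
  exact Finset.sum_congr rfl fun j _ => (EuclideanSpace.real_norm_sq_eq (x j)).symm

theorem norm_headProj_le (k : ℕ) (x : BlockSpace d) : ‖headProj k x‖ ≤ ‖x‖ := by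
  refine le_of_sq_le_sq ?_ (norm_nonneg x)
  rw [norm_headProj_sq]
  exact sum_le_hasSum _ (fun _ _ => sq_nonneg _) (hasSum_norm_sq_blockSpace x)

theorem norm_headDiv_headProj_sq (μ : ℕ → ℝ) (k : ℕ) (x : BlockSpace d) :
    ‖headDiv d μ k (headProj k x)‖ ^ 2 = ∑ j ∈ Finset.range k, (‖x j‖ / μ j) ^ 2 := by
  rw [headDiv, norm_coordDiv_sigma_sq (fun j : Fin k => μ j), Finset.sum_range]
  rfl

theorem norm_headDiv_headProj_le_one {x : BlockSpace d} (hx : x ∈ mixedEllipsoid d μ) (k : ℕ) :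
    ‖headDiv d μ k (headProj k x)‖ ≤ 1 := by
  obtain ⟨hs, hle⟩ := mem_mixedEllipsoid_iff.1 hx
  refine le_of_sq_le_sq ?_ zero_le_one
  rw [norm_headDiv_headProj_sq, one_pow]
  exact (hs.sum_le_tsum _ fun _ _ => sq_nonneg _).trans hle

theorem headEmb_mem_mixedEllipsoid {y : HeadSpace d k} (hy : ‖headDiv d μ k y‖ ≤ 1) :
    headEmb k y ∈ mixedEllipsoid d μ := by
  have hzero : ∀ j ∉ Finset.range k, (‖headEmb k y j‖ / μ j) ^ 2 = 0 := by
    intro j hj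
    rw [headEmb_apply_of_le y (by simpa using hj), norm_zero, zero_div, zero_pow two_ne_zero]
  refine mem_mixedEllipsoid_iff.2 ⟨summable_of_ne_finset_zero hzero, ?_⟩
  rw [tsum_eq_sum hzero, ← norm_headDiv_headProj_sq, headProj_headEmb]
  exact pow_le_one₀ (norm_nonneg _) hy

theorem norm_sub_headEmb_sq (x : BlockSpace d) (c : HeadSpace d k) :
    ‖x - headEmb k c‖ ^ 2 = ‖headProj k x - c‖ ^ 2 + ∑' j, ‖x (j + k)‖ ^ 2 := by
  have hsum := hasSum_norm_sq_blockSpace (x - headEmb k c)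
  have htail : ∀ j, (x - headEmb k c) (j + k) = x (j + k) := fun j => by
    rw [lp.coeFn_sub, Pi.sub_apply, headEmb_apply_of_le c (by omega), sub_zero]
  rw [← hsum.tsum_eq, ← hsum.summable.sum_add_tsum_nat_add k, ← norm_headProj_sq, map_sub,
    headProj_headEmb]
  simp only [htail]

theorem tsum_norm_sq_tail_le (hμ : ∀ j, k ≤ j → 0 < μ j) {ε : ℝ} (hε : ∀ j, k ≤ j → μ j ≤ ε)
    {x : BlockSpace d} (hx : x ∈ mixedEllipsoid d μ) :
    ∑' j, ‖x (j + k)‖ ^ 2 ≤ ε ^ 2 * (1 - ‖headDiv d μ k (headProj k x)‖ ^ 2) := by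
  obtain ⟨hs, hle⟩ := mem_mixedEllipsoid_iff.1 hx
  have hterm : ∀ j, ‖x (j + k)‖ ^ 2 ≤ ε ^ 2 * (‖x (j + k)‖ / μ (j + k)) ^ 2 := by
    intro j
    have hμj := hμ (j + k) (Nat.le_add_left k j)
    calc ‖x (j + k)‖ ^ 2 = (μ (j + k) * (‖x (j + k)‖ / μ (j + k))) ^ 2 := by
          rw [mul_div_cancel₀ _ hμj.ne']
      _ ≤ (ε * (‖x (j + k)‖ / μ (j + k))) ^ 2 := by
          gcongr
          exact hε (j + k) (Nat.le_add_left k j)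
      _ = _ := mul_pow _ _ _
  calc ∑' j, ‖x (j + k)‖ ^ 2 ≤ ∑' j, ε ^ 2 * (‖x (j + k)‖ / μ (j + k)) ^ 2 :=
        Summable.tsum_le_tsum hterm
          ((summable_nat_add_iff k).2 (hasSum_norm_sq_blockSpace x).summable)
          (((summable_nat_add_iff k).2 hs).mul_left _)
    _ = ε ^ 2 * ∑' j, (‖x (j + k)‖ / μ (j + k)) ^ 2 := tsum_mul_left
    _ ≤ _ := by
        gcongr
        rw [norm_headDiv_headProj_sq]
        linarith [hs.sum_add_tsum_nat_add k]

theorem mixedCoveringNumber_le_card (hμ : ∀ j, k ≤ j → 0 < μ j) {ε σ ρ : ℝ}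
    (hε : ∀ j, k ≤ j → μ j ≤ ε) (hρ : 0 ≤ ρ) (hσ : ε ^ 2 * (1 + σ) ≤ ρ ^ 2)
    {S : Finset (HeadSpace d k)}
    (hS : ∀ y, ‖headDiv d μ k y‖ ≤ 1 →
      ∃ c ∈ S, ‖y - c‖ ^ 2 ≤ ε ^ 2 * (‖headDiv d μ k y‖ ^ 2 + σ)) :
    mixedCoveringNumber d μ ρ ≤ S.card := by
  classical
  have hcover : IsCover ρ.toNNReal (mixedEllipsoid d μ) (S.image (headEmb k) : Finset _) := by
    rw [isCover_iff_subset_iUnion_closedBall]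
    intro x hx
    obtain ⟨c, hc, hxc⟩ := hS (headProj k x) (norm_headDiv_headProj_le_one hx k)
    refine Set.mem_biUnion (Finset.mem_coe.2 (Finset.mem_image_of_mem _ hc)) ?_
    rw [mem_closedBall, dist_eq_norm, Real.coe_toNNReal _ hρ]
    refine le_of_sq_le_sq ?_ hρ
    rw [norm_sub_headEmb_sq]
    linarith [tsum_norm_sq_tail_le hμ hε hx]
  refine hcover.externalCoveringNumber_le_encard.trans ?_
  rw [Set.encard_coe_eq_coe_finsetCard]
  exact_mod_cast Finset.card_image_le

theorem exists_finset_isCover_card_eq {X : Type*} [PseudoEMetricSpace X] {A : Set X} {r : ℝ≥0}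
    (h : externalCoveringNumber r A ≠ ⊤) :
    ∃ S : Finset X, IsCover r A S ∧ S.card = externalCoveringNumber r A := by
  have : Nonempty {C : Set X // IsCover r A C} := ⟨A, IsCover.rfl⟩
  obtain ⟨C, hC⟩ := ENat.exists_eq_iInf fun C : {C : Set X // IsCover r A C} => C.1.encard
  have hcard : C.1.encard = externalCoveringNumber r A := by rw [hC, iInf_subtype]; rfl
  have hfin : C.1.Finite := Set.encard_ne_top_iff.1 (hcard ▸ h)
  exact ⟨hfin.toFinset, hfin.coe_toFinset.symm ▸ C.2,
    hfin.encard_eq_coe_toFinset_card.symm.trans hcard⟩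

theorem prod_semiAxes_le_mixedCoveringNumber (hμ : ∀ j < k, 0 < μ j) {ρ : ℝ} (hρ : 0 ≤ ρ)
    (hN : mixedCoveringNumber d μ ρ ≠ ⊤) :
    ∏ i : (Σ j : Fin k, Fin (d j)), μ i.1 ≤ (mixedCoveringNumber d μ ρ).toNat *
      ρ ^ Fintype.card (Σ j : Fin k, Fin (d j)) := by
  classical
  obtain ⟨S, hS, hcard⟩ := exists_finset_isCover_card_eq hN
  rw [isCover_iff_subset_iUnion_closedBall] at hS
  have hhead : ∀ y, ‖headDiv d μ k y‖ ≤ 1 → ∃ c ∈ S.image (headProj k), ‖y - c‖ ≤ ρ := by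
    intro y hy
    obtain ⟨c, hc, hyc⟩ := Set.mem_iUnion₂.1 (hS (headEmb_mem_mixedEllipsoid hy))
    rw [mem_closedBall, dist_eq_norm, Real.coe_toNNReal _ hρ] at hyc
    refine ⟨headProj k c, Finset.mem_image_of_mem _ hc, ?_⟩
    calc ‖y - headProj k c‖ = ‖headProj k (headEmb k y - c)‖ := by rw [map_sub, headProj_headEmb]
      _ ≤ ρ := (norm_headProj_le k _).trans hyc
  refine (prod_semiAxes_le_card_mul_pow (fun i => hμ _ i.1.2) hρ hhead).trans ?_
  rw [mixedCoveringNumber, ← hcard, ENat.toNat_natCast]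
  gcongr
  exact Finset.card_image_le

end BlockSpace

section Rates

variable {d : ℕ → ℕ} {μ : ℕ → ℝ} {k : ℕ} {ε γ : ℝ}

theorem card_headIndex (d : ℕ → ℕ) (k : ℕ) :
    Fintype.card (Σ j : Fin k, Fin (d j)) = dimBar d k := by
  rw [Fintype.card_sigma, dimBar, Finset.sum_range]
  simp only [Fintype.card_fin]

theorem prod_headIndex (d : ℕ → ℕ) (μ : ℕ → ℝ) (k : ℕ) :
    ∏ i : (Σ j : Fin k, Fin (d j)), μ i.1 = ∏ j ∈ Finset.range k, μ j ^ d j := by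
  rw [Fintype.prod_sigma, Finset.prod_range]
  simp only [Finset.prod_const, Finset.card_univ, Fintype.card_fin]

theorem semiAxisMean_nonneg (d : ℕ → ℕ) (hμ : ∀ j < k, 0 < μ j) : 0 ≤ semiAxisMean d μ k :=
  Finset.prod_nonneg fun _ hj => Real.rpow_nonneg (hμ _ (Finset.mem_range.1 hj)).le _

theorem semiAxisMean_pow (hμ : ∀ j < k, 0 < μ j) (hD : dimBar d k ≠ 0) :
    semiAxisMean d μ k ^ dimBar d k = ∏ j ∈ Finset.range k, μ j ^ d j := by
  rw [semiAxisMean, ← Finset.prod_pow]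
  refine Finset.prod_congr rfl fun j hj => ?_
  rw [← Real.rpow_mul_natCast (hμ j (Finset.mem_range.1 hj)).le,
    div_mul_cancel₀ _ (Nat.cast_ne_zero.2 hD), Real.rpow_natCast]

theorem rpow_one_div_mul_pow {N : ℝ} (hN : 0 ≤ N) (ρ : ℝ) {n : ℕ} (hn : n ≠ 0) :
    (N ^ (1 / (n : ℝ)) * ρ) ^ n = N * ρ ^ n := by
  rw [mul_pow, one_div, Real.rpow_inv_natCast_pow hN hn]

theorem semiAxisMean_le_rpow_mul (hμ : ∀ j < k, 0 < μ j) (hD : dimBar d k ≠ 0) {ρ : ℝ}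
    (hρ : 0 ≤ ρ) (hN : mixedCoveringNumber d μ ρ ≠ ⊤) :
    semiAxisMean d μ k ≤
      ((mixedCoveringNumber d μ ρ).toNat : ℝ) ^ (1 / (dimBar d k : ℝ)) * ρ := by
  refine le_of_pow_le_pow_left₀ hD (by positivity) ?_
  rw [rpow_one_div_mul_pow (Nat.cast_nonneg _) ρ hD, semiAxisMean_pow hμ hD, ← prod_headIndex,
    ← card_headIndex]
  exact prod_semiAxes_le_mixedCoveringNumber hμ hρ hN

theorem apply_le_dimBar {j : ℕ} (hj : j < k) : d j ≤ dimBar d k :=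
  Finset.single_le_sum (fun _ _ => Nat.zero_le _) (Finset.mem_range.2 hj)

theorem le_dimBar_of_one_le (hd : ∀ j < k, 1 ≤ d j) : k ≤ dimBar d k := by
  calc k = ∑ _j ∈ Finset.range k, 1 := by rw [Finset.sum_const, Finset.card_range, smul_eq_mul,
        mul_one]
    _ ≤ dimBar d k := Finset.sum_le_sum fun j hj => hd j (Finset.mem_range.1 hj)

theorem one_le_of_dimBar_ne_zero (hD : dimBar d k ≠ 0) : 1 ≤ k :=
  Nat.one_le_iff_ne_zero.2 fun hk => hD (by rw [hk, dimBar, Finset.sum_range_zero])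

theorem one_le_logb_dimBar (hD : 2 ≤ dimBar d k) : 1 ≤ Real.logb 2 (dimBar d k) := by
  have hD' : (2 : ℝ) ≤ dimBar d k := by exact_mod_cast hD
  rwa [Real.le_logb_iff_rpow_le one_lt_two (by positivity), Real.rpow_one]

/-- The order `γ k log₂ D / D` of the relative error `κ_k - 1`, where `D = d₁ + ⋯ + d_k`. -/
noncomputable def relError (d : ℕ → ℕ) (k : ℕ) (γ : ℝ) : ℝ :=
  γ * (k : ℝ) * Real.logb 2 (dimBar d k : ℝ) / (dimBar d k : ℝ)

theorem relError_nonneg (hD : 0 < dimBar d k) (hγ : 0 ≤ γ) : 0 ≤ relError d k γ := by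
  have hlog : 0 ≤ Real.logb 2 (dimBar d k) :=
    Real.logb_nonneg one_lt_two (Nat.one_le_cast.2 hD)
  unfold relError
  positivity

theorem relError_mul_dimBar (hD : dimBar d k ≠ 0) :
    relError d k γ * dimBar d k = γ * k * Real.logb 2 (dimBar d k) :=
  div_mul_cancel₀ _ (Nat.cast_ne_zero.2 hD)

/-- The relative excess `D^{-γ} √(k+1)` of the radius `ε_γ` over `ε`. -/
noncomputable def radiusExcess (d : ℕ → ℕ) (k : ℕ) (γ : ℝ) : ℝ :=
  (dimBar d k : ℝ) ^ (-γ) * √((k : ℝ) + 1)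

theorem radiusExcess_nonneg (d : ℕ → ℕ) (k : ℕ) (γ : ℝ) : 0 ≤ radiusExcess d k γ := by
  unfold radiusExcess
  positivity

theorem radiusExcess_sq (d : ℕ → ℕ) (k : ℕ) (γ : ℝ) :
    radiusExcess d k γ ^ 2 = (k + 1) * ((dimBar d k : ℝ) ^ (-γ)) ^ 2 := by
  rw [radiusExcess, mul_pow, Real.sq_sqrt (by positivity), mul_comm]

theorem radiusExcess_le (hD : dimBar d k ≠ 0) (hγ : 1 ≤ γ) :
    radiusExcess d k γ ≤ 2 * k / dimBar d k := by
  have hk : (1 : ℝ) ≤ k := by exact_mod_cast one_le_of_dimBar_ne_zero hD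
  have hD1 : (1 : ℝ) ≤ dimBar d k := by exact_mod_cast Nat.one_le_iff_ne_zero.2 hD
  have hsqrt : √((k : ℝ) + 1) ≤ 2 * k := by
    rw [Real.sqrt_le_left (by positivity)]
    nlinarith
  calc radiusExcess d k γ ≤ (dimBar d k : ℝ) ^ (-1 : ℝ) * (2 * k) := by
        unfold radiusExcess
        gcongr
    _ = 2 * k / dimBar d k := by rw [Real.rpow_neg_one, inv_mul_eq_div]

theorem radiusExcess_le_two (hd : ∀ j < k, 1 ≤ d j) (hD : dimBar d k ≠ 0) (hγ : 1 ≤ γ) :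
    radiusExcess d k γ ≤ 2 := by
  have hk : (k : ℝ) ≤ dimBar d k := by exact_mod_cast le_dimBar_of_one_le hd
  refine (radiusExcess_le hD hγ).trans ?_
  rw [mul_div_assoc]
  exact mul_le_of_le_one_right zero_le_two (div_le_one_of_le₀ hk (Nat.cast_nonneg _))

theorem radiusExcess_le_relError (hD : 2 ≤ dimBar d k) (hγ : 1 ≤ γ) :
    radiusExcess d k γ ≤ 2 * relError d k γ := by
  have hlog := one_le_logb_dimBar hD
  refine (radiusExcess_le (by omega) hγ).trans ?_
  rw [relError, ← mul_div_assoc]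
  gcongr
  calc (k : ℝ) = 1 * k * 1 := by ring
    _ ≤ γ * k * Real.logb 2 (dimBar d k) := by gcongr

theorem mixedCoveringNumber_epsGamma_of_cover (hμ : ∀ j, k ≤ j → 0 < μ j)
    (htail : ∀ j, k ≤ j → μ j ≤ ε) (hε : 0 ≤ ε) {σ : ℝ}
    (hσ : σ ≤ (k + 1) * ((dimBar d k : ℝ) ^ (-γ)) ^ 2) {S : Finset (HeadSpace d k)}
    (hS : ∀ y, ‖headDiv d μ k y‖ ≤ 1 →
      ∃ c ∈ S, ‖y - c‖ ^ 2 ≤ ε ^ 2 * (‖headDiv d μ k y‖ ^ 2 + σ)) :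
    mixedCoveringNumber d μ (epsGamma d k γ ε) ≠ ⊤ ∧
      ((mixedCoveringNumber d μ (epsGamma d k γ ε)).toNat : ℝ) *
          epsGamma d k γ ε ^ dimBar d k ≤
        (1 + radiusExcess d k γ) ^ dimBar d k * (S.card * ε ^ dimBar d k) := by
  have hη := radiusExcess_nonneg d k γ
  have heps : epsGamma d k γ ε = ε * (1 + radiusExcess d k γ) := rfl
  have hle : mixedCoveringNumber d μ (epsGamma d k γ ε) ≤ S.card := by
    refine mixedCoveringNumber_le_card hμ htail (by rw [heps]; positivity) ?_ hS
    rw [heps, mul_pow]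
    gcongr
    nlinarith [radiusExcess_sq d k γ]
  refine ⟨ne_top_of_le_ne_top (ENat.natCast_ne_top _) hle, ?_⟩
  rw [heps, mul_pow, ← mul_assoc, mul_comm _ ((1 + radiusExcess d k γ) ^ dimBar d k)]
  gcongr
  exact ENat.toNat_le_of_le_natCast hle

theorem exists_half_pow_le_dimBar_rpow_neg (hD : 2 ≤ dimBar d k) (hγ : 1 ≤ γ) :
    ∃ m : ℕ, (1 / 2 : ℝ) ^ m ≤ (dimBar d k : ℝ) ^ (-γ) ∧
      (m : ℝ) + 1 ≤ (1 + 2 * relError d k γ) ^ dimBar d k := by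
  have hD0 : (0 : ℝ) < dimBar d k := by exact_mod_cast (by omega : 0 < dimBar d k)
  have hk : (1 : ℝ) ≤ k := by exact_mod_cast one_le_of_dimBar_ne_zero (by omega : dimBar d k ≠ 0)
  have hlog : 1 ≤ γ * Real.logb 2 (dimBar d k) :=
    one_le_mul_of_one_le_of_one_le hγ (one_le_logb_dimBar hD)
  obtain ⟨m, hm, hm'⟩ : ∃ m : ℕ, γ * Real.logb 2 (dimBar d k) ≤ m ∧
      (m : ℝ) < γ * Real.logb 2 (dimBar d k) + 1 :=
    ⟨_, Nat.le_ceil _, Nat.ceil_lt_add_one (by linarith)⟩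
  refine ⟨m, ?_, ?_⟩
  · calc (1 / 2 : ℝ) ^ m = 2 ^ (-(m : ℝ)) := by
          rw [Real.rpow_neg zero_le_two, Real.rpow_natCast, one_div, inv_pow]
      _ ≤ 2 ^ (Real.logb 2 (dimBar d k) * -γ) := by
          gcongr
          · exact one_le_two
          · linarith
      _ = (dimBar d k : ℝ) ^ (-γ) := by
          rw [Real.rpow_mul zero_le_two, Real.rpow_logb two_pos (by norm_num) hD0]
  · have hmk : (m : ℝ) ≤ dimBar d k * (2 * relError d k γ) := by
      rw [mul_left_comm, mul_comm (dimBar d k : ℝ), relError_mul_dimBar (by omega)]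
      nlinarith [le_mul_of_one_le_right (zero_le_one.trans hlog) hk]
    have hL := relError_nonneg (by omega : 0 < dimBar d k) (zero_le_one.trans hγ)
    calc (m : ℝ) + 1 ≤ 1 + dimBar d k * (2 * relError d k γ) := by linarith
      _ ≤ _ := one_add_mul_le_pow (by linarith) _

theorem mixedCoveringNumber_epsGamma_le_of_shells (hμ : ∀ n, 0 < μ n) (hε : 0 < ε)
    (hhead : ∀ j < k, ε ≤ μ j) (htail : ∀ j, k ≤ j → μ j ≤ ε) (hd : ∀ j < k, 1 ≤ d j)
    (hD : 2 ≤ dimBar d k) (hγ : 1 ≤ γ) :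
    mixedCoveringNumber d μ (epsGamma d k γ ε) ≠ ⊤ ∧
      ((mixedCoveringNumber d μ (epsGamma d k γ ε)).toNat : ℝ) *
          epsGamma d k γ ε ^ dimBar d k ≤
        (15 * (1 + 2 * relError d k γ)) ^ dimBar d k * ∏ j ∈ Finset.range k, μ j ^ d j := by
  obtain ⟨m, hmτ, hm⟩ := exists_half_pow_le_dimBar_rpow_neg hD hγ
  obtain ⟨S, hcard, hS⟩ := exists_finset_graded_cover_ellipsoid
    (μ := fun i : (Σ j : Fin k, Fin (d j)) => μ i.1) hε (fun i => hhead _ i.1.2) m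
  rw [card_headIndex, prod_headIndex] at hcard
  have hσ : ((1 / 2 : ℝ) ^ m) ^ 2 ≤ (k + 1) * ((dimBar d k : ℝ) ^ (-γ)) ^ 2 := by
    calc ((1 / 2 : ℝ) ^ m) ^ 2 ≤ 1 * ((dimBar d k : ℝ) ^ (-γ)) ^ 2 := by rw [one_mul]; gcongr
      _ ≤ _ := by gcongr; exact le_add_of_nonneg_left (Nat.cast_nonneg k)
  obtain ⟨hfin, hN⟩ := mixedCoveringNumber_epsGamma_of_cover (fun j _ => hμ j) htail hε.le hσ hS
  refine ⟨hfin, hN.trans ?_⟩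
  have hη : 1 + radiusExcess d k γ ≤ 3 := by
    linarith [radiusExcess_le_two hd (by omega) hγ]
  have hη0 := radiusExcess_nonneg d k γ
  have hP : 0 ≤ ∏ j ∈ Finset.range k, μ j ^ d j :=
    Finset.prod_nonneg fun j _ => pow_nonneg (hμ j).le _
  calc (1 + radiusExcess d k γ) ^ dimBar d k * (S.card * ε ^ dimBar d k)
      ≤ 3 ^ dimBar d k * ((1 + 2 * relError d k γ) ^ dimBar d k *
          (5 ^ dimBar d k * ∏ j ∈ Finset.range k, μ j ^ d j)) := by
        refine mul_le_mul (by gcongr) (hcard.trans ?_) (by positivity) (by positivity)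
        gcongr
    _ = _ := by
        rw [show (15 : ℝ) = 3 * 5 by norm_num, mul_pow, mul_pow]
        ring

theorem blockFactor_le (hD : 2 ≤ dimBar d k) (hγ : 1 ≤ γ) {j : ℕ} (hj : j < k) :
    370 * (d j : ℝ) ^ 3 / ((dimBar d k : ℝ) ^ (-γ)) ^ 2 ≤ (dimBar d k : ℝ) ^ (14 * γ) := by
  have hD2 : (2 : ℝ) ≤ dimBar d k := by exact_mod_cast hD
  have hdj : (d j : ℝ) ≤ dimBar d k := by exact_mod_cast apply_le_dimBar hj
  rw [div_le_iff₀ (by positivity), ← Real.rpow_mul_natCast (by positivity),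
    ← Real.rpow_add (by positivity)]
  calc 370 * (d j : ℝ) ^ 3 ≤ 2 ^ 9 * (d j : ℝ) ^ 3 := by gcongr; norm_num
    _ ≤ (dimBar d k : ℝ) ^ 9 * (dimBar d k : ℝ) ^ 3 := by gcongr
    _ = (dimBar d k : ℝ) ^ (12 : ℝ) := by rw [← pow_add]; norm_cast
    _ ≤ _ := Real.rpow_le_rpow_of_exponent_le (by linarith) (by push_cast; linarith)

theorem dimBar_rpow_pow_eq (hD : dimBar d k ≠ 0) (a : ℝ) :
    ((dimBar d k : ℝ) ^ (a * γ)) ^ k = (((2 : ℝ) ^ a) ^ relError d k γ) ^ dimBar d k := by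
  have hD0 : (0 : ℝ) < dimBar d k := by exact_mod_cast Nat.pos_of_ne_zero hD
  rw [← Real.rpow_mul_natCast hD0.le, ← Real.rpow_mul_natCast (by positivity),
    relError_mul_dimBar hD, ← Real.rpow_mul zero_le_two]
  conv_lhs => rw [← Real.rpow_logb two_pos (by norm_num) hD0]
  rw [← Real.rpow_mul zero_le_two]
  ring_nf

theorem prod_blockFactor_mul_pow_le (hμ : ∀ j < k, 0 ≤ μ j) (hε : 0 < ε) (hD : 2 ≤ dimBar d k)
    (hγ : 1 ≤ γ) :
    (∏ j : Fin k, (370 * (Fintype.card (Fin (d j)) : ℝ) ^ 3 / ((dimBar d k : ℝ) ^ (-γ)) ^ 2 *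
        (μ j / ε) ^ Fintype.card (Fin (d j)))) * ε ^ dimBar d k ≤
      (((2 : ℝ) ^ (14 : ℝ)) ^ relError d k γ) ^ dimBar d k *
        ∏ j ∈ Finset.range k, μ j ^ d j := by
  have hμε : ∀ j : Fin k, 0 ≤ μ j / ε := fun j => div_nonneg (hμ j j.2) hε.le
  simp only [Fintype.card_fin]
  calc _ ≤ (∏ j : Fin k, ((dimBar d k : ℝ) ^ (14 * γ) * (μ j / ε) ^ d j)) * ε ^ dimBar d k := by
        refine mul_le_mul_of_nonneg_right ?_ (by positivity)
        exact Finset.prod_le_prod (fun j _ => mul_nonneg (by positivity) (pow_nonneg (hμε j) _))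
          fun j _ => mul_le_mul_of_nonneg_right (blockFactor_le hD hγ j.2) (pow_nonneg (hμε j) _)
    _ = ((dimBar d k : ℝ) ^ (14 * γ)) ^ k * ∏ j ∈ Finset.range k, μ j ^ d j := by
        simp only [div_pow]
        rw [← Finset.prod_range fun j => (dimBar d k : ℝ) ^ (14 * γ) * (μ j ^ d j / ε ^ d j),
          Finset.prod_mul_distrib, Finset.prod_const, Finset.card_range, Finset.prod_div_distrib,
          Finset.prod_pow_eq_pow_sum, ← dimBar, mul_assoc, div_mul_cancel₀ _ (by positivity)]
    _ = _ := by rw [dimBar_rpow_pow_eq (by omega)]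

theorem mixedCoveringNumber_epsGamma_le_of_blocks (hμ : ∀ n, 0 < μ n) (hε : 0 < ε)
    (hhead : ∀ j < k, ε ≤ μ j) (htail : ∀ j, k ≤ j → μ j ≤ ε) (hd : ∀ j < k, 1 ≤ d j)
    (hD : 2 ≤ dimBar d k) (hγ : 1 ≤ γ) :
    mixedCoveringNumber d μ (epsGamma d k γ ε) ≠ ⊤ ∧
      ((mixedCoveringNumber d μ (epsGamma d k γ ε)).toNat : ℝ) *
          epsGamma d k γ ε ^ dimBar d k ≤
        (((2 : ℝ) ^ (14 : ℝ)) ^ relError d k γ * (1 + 2 * relError d k γ)) ^ dimBar d k *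
          ∏ j ∈ Finset.range k, μ j ^ d j := by
  have hD1 : (1 : ℝ) ≤ dimBar d k := by exact_mod_cast (by omega : 1 ≤ dimBar d k)
  have : ∀ j : Fin k, Nonempty (Fin (d j)) := fun j => ⟨⟨0, hd j j.2⟩⟩
  have hτ : 0 < (dimBar d k : ℝ) ^ (-γ) := by positivity
  obtain ⟨S, hcard, hS⟩ := exists_finset_block_cover_ellipsoid (β := fun j : Fin k => Fin (d j))
    (μ := fun j => μ j) hε (fun j => hhead j j.2) hτ
    (Real.rpow_le_one_of_one_le_of_nonpos hD1 (by linarith))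
  have hσ : (Fintype.card (Fin k) : ℝ) * ((dimBar d k : ℝ) ^ (-γ)) ^ 2 ≤
      (k + 1) * ((dimBar d k : ℝ) ^ (-γ)) ^ 2 := by
    rw [Fintype.card_fin]
    gcongr
    exact le_add_of_nonneg_right zero_le_one
  obtain ⟨hfin, hN⟩ := mixedCoveringNumber_epsGamma_of_cover (fun j _ => hμ j) htail hε.le hσ hS
  refine ⟨hfin, hN.trans ?_⟩
  have hSε := (mul_le_mul_of_nonneg_right hcard (pow_nonneg hε.le (dimBar d k))).trans
    (prod_blockFactor_mul_pow_le (fun j _ => (hμ j).le) hε hD hγ)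
  have hη := radiusExcess_nonneg d k γ
  have hL := relError_nonneg (by omega : 0 < dimBar d k) (zero_le_one.trans hγ)
  rw [mul_pow, mul_comm (_ ^ dimBar d k) ((1 + _) ^ dimBar d k), mul_assoc]
  gcongr
  exact radiusExcess_le_relError hD hγ

theorem mixedCoveringNumber_epsGamma_le (hμ : ∀ n, 0 < μ n) (hε : 0 < ε)
    (hhead : ∀ j < k, ε ≤ μ j) (htail : ∀ j, k ≤ j → μ j ≤ ε) (hd : ∀ j < k, 1 ≤ d j)
    (hD : 2 ≤ dimBar d k) (hγ : 1 ≤ γ) :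
    mixedCoveringNumber d μ (epsGamma d k γ ε) ≠ ⊤ ∧
      ((mixedCoveringNumber d μ (epsGamma d k γ ε)).toNat : ℝ) *
          epsGamma d k γ ε ^ dimBar d k ≤
        (1 + 2 ^ 16 * relError d k γ) ^ dimBar d k * ∏ j ∈ Finset.range k, μ j ^ d j := by
  have hL0 := relError_nonneg (by omega : 0 < dimBar d k) (zero_le_one.trans hγ)
  have hP : 0 ≤ ∏ j ∈ Finset.range k, μ j ^ d j :=
    Finset.prod_nonneg fun j _ => pow_nonneg (hμ j).le _
  rcases le_total 1 (relError d k γ) with hL | hL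
  · refine (mixedCoveringNumber_epsGamma_le_of_shells hμ hε hhead htail hd hD hγ).imp_right
      fun hN => hN.trans ?_
    gcongr
    linarith
  · refine (mixedCoveringNumber_epsGamma_le_of_blocks hμ hε hhead htail hd hD hγ).imp_right
      fun hN => hN.trans ?_
    gcongr
    have hbernoulli := rpow_one_add_le_one_add_mul_self (s := (2 : ℝ) ^ (14 : ℝ) - 1)
      (by norm_num) hL0 hL
    rw [add_sub_cancel] at hbernoulli
    calc ((2 : ℝ) ^ (14 : ℝ)) ^ relError d k γ * (1 + 2 * relError d k γ)
        ≤ (1 + relError d k γ * (2 ^ (14 : ℝ) - 1)) * (1 + 2 * relError d k γ) := by gcongr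
      _ ≤ 1 + 2 ^ 16 * relError d k γ := by norm_num; nlinarith

theorem rpow_mul_epsGamma_le_mul_semiAxisMean (hμ : ∀ n, 0 < μ n) (hε : 0 < ε)
    (hhead : ∀ j < k, ε ≤ μ j) (htail : ∀ j, k ≤ j → μ j ≤ ε) (hd : ∀ j < k, 1 ≤ d j)
    (hD : 2 ≤ dimBar d k) (hγ : 1 ≤ γ) :
    mixedCoveringNumber d μ (epsGamma d k γ ε) ≠ ⊤ ∧
      ((mixedCoveringNumber d μ (epsGamma d k γ ε)).toNat : ℝ) ^ (1 / (dimBar d k : ℝ)) *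
          epsGamma d k γ ε ≤ (1 + 2 ^ 16 * relError d k γ) * semiAxisMean d μ k := by
  have hD0 : dimBar d k ≠ 0 := by omega
  have hmean := semiAxisMean_nonneg d (k := k) fun j _ => hμ j
  have hL := relError_nonneg (Nat.pos_of_ne_zero hD0) (zero_le_one.trans hγ)
  refine (mixedCoveringNumber_epsGamma_le hμ hε hhead htail hd hD hγ).imp_right fun hN =>
    le_of_pow_le_pow_left₀ hD0 (by positivity) ?_
  rwa [rpow_one_div_mul_pow (Nat.cast_nonneg _) _ hD0, mul_pow,
    semiAxisMean_pow (fun j _ => hμ j) hD0]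

end Rates

theorem mainTheorem4_general :
    ∃ (C : ℝ) (κ : ℕ → (ℕ → ℕ) → ℝ → ℝ), 0 < C ∧
      (∀ (k : ℕ) (d : ℕ → ℕ) (γ : ℝ), 0 < dimBar d k → 0 ≤ γ →
        |κ k d γ - 1| ≤ C * (γ * (k : ℝ) * Real.logb 2 (dimBar d k : ℝ) / (dimBar d k : ℝ))) ∧
      ∀ (d : ℕ → ℕ) (μ : ℕ → ℝ), (∀ n, 0 < μ n) →
        ∀ (k : ℕ) (ε γ : ℝ), 0 < ε → (∀ j < k, ε ≤ μ j) → (∀ j, k ≤ j → μ j ≤ ε) →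
          (∀ j < k, 1 ≤ d j) → 2 ≤ dimBar d k → 1 ≤ γ →
          mixedCoveringNumber d μ (epsGamma d k γ ε) ≠ ⊤ ∧
          ((mixedCoveringNumber d μ (epsGamma d k γ ε)).toNat : ℝ) ^ (1 / (dimBar d k : ℝ)) *
              epsGamma d k γ ε ≤ κ k d γ * semiAxisMean d μ k ∧
          semiAxisMean d μ k ≤
            ((mixedCoveringNumber d μ (epsGamma d k γ ε)).toNat : ℝ) ^ (1 / (dimBar d k : ℝ)) *
              epsGamma d k γ ε := by
  refine ⟨2 ^ 16, fun k d γ => 1 + 2 ^ 16 * relError d k γ, by norm_num, ?_, ?_⟩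
  · intro k d γ hD hγ
    have hL := relError_nonneg hD hγ
    rw [add_sub_cancel_left, abs_of_nonneg (by positivity), relError]
  · intro d μ hμ k ε γ hε hhead htail hd hD hγ
    obtain ⟨hfin, hupper⟩ := rpow_mul_epsGamma_le_mul_semiAxisMean hμ hε hhead htail hd hD hγ
    have hρ : 0 ≤ epsGamma d k γ ε := by unfold epsGamma; positivity
    exact ⟨hfin, hupper, semiAxisMean_le_rpow_mul (fun j _ => hμ j) (by omega) hρ hfin⟩

theorem mainTheorem4 :
    ∃ (C : ℝ) (κ : ℕ → (ℕ → ℕ) → ℝ → ℝ), 0 < C ∧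
      (∀ (k : ℕ) (d : ℕ → ℕ) (γ : ℝ), 1 ≤ k → (∀ j < k, 9 ≤ d j) → 1 ≤ γ →
        |κ k d γ - 1| ≤ C * (γ * (k : ℝ) * Real.logb 2 (dimBar d k : ℝ) / (dimBar d k : ℝ))) ∧
      ∀ (d : ℕ → ℕ) (μ : ℕ → ℝ), (∀ n, 1 ≤ d n) → (∀ n, 0 < μ n) → Antitone μ →
        ∀ (k : ℕ) (ε γ : ℝ), 1 ≤ k → 0 < ε → μ k ≤ ε → ε < μ (k - 1) →
          (∀ j < k, 9 ≤ d j) → 1 ≤ γ →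
          mixedCoveringNumber d μ (epsGamma d k γ ε) ≠ ⊤ ∧
          ((mixedCoveringNumber d μ (epsGamma d k γ ε)).toNat : ℝ) ^ (1 / (dimBar d k : ℝ)) *
              epsGamma d k γ ε ≤ κ k d γ * semiAxisMean d μ k ∧
          semiAxisMean d μ k ≤
            ((mixedCoveringNumber d μ (epsGamma d k γ ε)).toNat : ℝ) ^ (1 / (dimBar d k : ℝ)) *
              epsGamma d k γ ε := by
  obtain ⟨C, κ, hC, hκ, hN⟩ := mainTheorem4_general
  have hdim {d : ℕ → ℕ} {k : ℕ} (hk : 1 ≤ k) (hd : ∀ j < k, 9 ≤ d j) : 9 ≤ dimBar d k :=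
    (hd 0 hk).trans (apply_le_dimBar hk)
  exact ⟨C, κ, hC, fun k d γ hk hd hγ => hκ k d γ (by linarith [hdim hk hd]) (by linarith),
    fun d μ hd1 hμ hanti k ε γ hk hε hkε hεk hd hγ => hN d μ hμ k ε γ hε
      (fun j hj => hεk.le.trans (hanti (by omega))) (fun j hj => (hanti hj).trans hkε)
      (fun j _ => hd1 j) (by linarith [hdim hk hd]) hγ⟩
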